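/- Let $k$ be a field of characteristic zero and let $L$ be a Lie algebra over $k$ with a decreasing filtration by subspaces $L=L^1\supseteq L^2\supseteq L^3\supseteq\cdots$ such that $[L^i,L^j]\subseteq L^{i+j}$. Write $L_p=L/L^{p+1}$, with the induced filtration. Assume that every $L_p$ is finite-dimensional and that $L$ is complete, i.e. the canonical map $L\to\varprojlim_p L_p$ is bijective. Let $K=\varinjlim_p K^p$, where $K^p=\mathrm{Hom}_k(L_p,k)$, be the dual Lie coalgebra. Filter the enveloping algebra $U(L_p)$, with augmentation ideal $U(L_p)_+$, by the ideals $F^1=U(L_p)_+$, $F^{q+1}=F^q\cdot U(L_p)_++\big((L_p)^{q+1}\big)$, where $(L_p)^{q+1}$ denotes the image of $L^{q+1}$ in $L_p$ and $\big((L_p)^{q+1}\big)$ is the two-sided ideal generated by it. Put $U^j(L_p)=U(L_p)/F^{j+1}$ and $U^c_j(K^p)=\mathrm{Hom}_k(U^j(L_p),k)$, and let $$U^c(K)=\varinjlim_{j,p}U^c_j(K^p).$$ This is a commutative algebra under the shuffle product, the product dual to the coproduct of the enveloping algebras (the algebra homomorphism $\Delta$ with $\Delta(\ell)=\ell\otimes1+1\otimes\ell$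 for $\ell$ in the Lie algebra), with unit map $\eta$, and a coalgebra under the coproduct dual to the product of the enveloping algebras, with counit $\epsilon$ (evaluation at $1$). Let $\star$ be the convolution product on $\mathrm{End}_k(U^c(K))$, let $J=\mathbf 1-\eta\circ\epsilon$, and let $$e=\log^\star(\mathbf 1)=J-\frac{J^{\star2}}2+\frac{J^{\star3}}3-\cdots:U^c(K)\to U^c(K)$$ be the Euler idempotent (a locally finite sum). Let $\pi:U^c(K)\to K$ be the natural map, given by restricting functionals from the enveloping algebras to the Lie algebras. Then there is a unique linear map $s:K\to U^c(K)$ with image equal to the image of $e$ and $\pi\circ s=\mathrm{id}_K$; it is injective and $e=s\circ\pi$. The algebra homomorphism $$\psi:\mathrm{Sym}(K)\to U^c(K)$$ from the free commutative algebra on $K$ that extends $s$ is an isomorphism of commutative algebras, where $U^c(K)$ carries the shuffle product. -/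

import Mathlib

noncomputable section

namespace FilteredLie

open scoped TensorProduct

section Enveloping

attribute [local instance] LieRing.ofAssociativeRing

variable (k : Type*) [Field k] (L : Type*) [LieRing L] [LieAlgebra k L]

/-- The linear map `ℓ ↦ ℓ ⊗ 1 + 1 ⊗ ℓ`, a morphism of Lie algebras. -/
def primitiveLieHom :
    L →ₗ⁅k⁆ UniversalEnvelopingAlgebra k L ⊗[k] UniversalEnvelopingAlgebra k L :=
  { (TensorProduct.mk k _ _).flip 1 ∘ₗ (UniversalEnvelopingAlgebra.ι k : L →ₗ⁅k⁆ _).toLinearMap +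
      TensorProduct.mk k _ _ 1 ∘ₗ (UniversalEnvelopingAlgebra.ι k : L →ₗ⁅k⁆ _).toLinearMap with
    map_lie' := by
      intro x y
      simp only [LinearMap.add_apply, LinearMap.comp_apply, LinearMap.flip_apply,
        TensorProduct.mk_apply, LieHom.coe_toLinearMap, AddHom.toFun_eq_coe, LinearMap.coe_toAddHom,
        LieHom.map_lie, LieRing.of_associative_ring_bracket, TensorProduct.sub_tmul,
        TensorProduct.tmul_sub, mul_add, add_mul, Algebra.TensorProduct.tmul_mul_tmul, one_mul,
        mul_one]
      abel }

/-- The coproduct of the enveloping algebra: the algebra morphism with `Δ ℓ = ℓ ⊗ 1 + 1 ⊗ ℓ` for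
`ℓ` in the Lie algebra (the shuffle coproduct). -/
def envComul : UniversalEnvelopingAlgebra k L →ₐ[k]
    UniversalEnvelopingAlgebra k L ⊗[k] UniversalEnvelopingAlgebra k L :=
  UniversalEnvelopingAlgebra.lift k (primitiveLieHom k L)

/-- The counit of the enveloping algebra: the algebra morphism vanishing on the Lie algebra. -/
def envCounit : UniversalEnvelopingAlgebra k L →ₐ[k] k :=
  UniversalEnvelopingAlgebra.lift k (0 : L →ₗ⁅k⁆ k)

variable {k L}

lemma envComul_ι (x : L) : envComul k L (UniversalEnvelopingAlgebra.ι k x) =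
    UniversalEnvelopingAlgebra.ι k x ⊗ₜ 1 + 1 ⊗ₜ UniversalEnvelopingAlgebra.ι k x := by
  rw [envComul, UniversalEnvelopingAlgebra.lift_ι_apply]
  rfl

lemma envCounit_ι (x : L) : envCounit k L (UniversalEnvelopingAlgebra.ι k x) = 0 := by
  rw [envCounit, UniversalEnvelopingAlgebra.lift_ι_apply]
  rfl

lemma env_hom_ext {A : Type*} [Ring A] [Algebra k A]
    {f g : UniversalEnvelopingAlgebra k L →ₐ[k] A}
    (h : ∀ x : L, f (UniversalEnvelopingAlgebra.ι k x) = g (UniversalEnvelopingAlgebra.ι k x)) :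
    f = g :=
  UniversalEnvelopingAlgebra.hom_ext k (LieHom.ext h)

instance : Bialgebra k (UniversalEnvelopingAlgebra k L) :=
  Bialgebra.ofAlgHom (envComul k L) (envCounit k L)
    (env_hom_ext fun x => by
      simp [envComul_ι, TensorProduct.add_tmul, TensorProduct.tmul_add,
        -UniversalEnvelopingAlgebra.ι_apply, Algebra.TensorProduct.one_def, add_assoc])
    (env_hom_ext fun x => by
      simp [envComul_ι, envCounit_ι, -UniversalEnvelopingAlgebra.ι_apply])
    (env_hom_ext fun x => by
      simp [envComul_ι, envCounit_ι, -UniversalEnvelopingAlgebra.ι_apply])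

lemma comul_ι (x : L) : Coalgebra.comul (R := k) (UniversalEnvelopingAlgebra.ι k x) =
    UniversalEnvelopingAlgebra.ι k x ⊗ₜ[k] 1 + 1 ⊗ₜ UniversalEnvelopingAlgebra.ι k x :=
  envComul_ι x

lemma counit_ι (x : L) :
    Coalgebra.counit (R := k) (UniversalEnvelopingAlgebra.ι k x) = (0 : k) :=
  envCounit_ι x

instance : Coalgebra.IsCocomm k (UniversalEnvelopingAlgebra k L) where
  comm_comp_comul := by
    have h : (Algebra.TensorProduct.comm k (UniversalEnvelopingAlgebra k L)
        (UniversalEnvelopingAlgebra k L)).toAlgHom.comp (envComul k L) = envComul k L :=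
      env_hom_ext fun x => by
        simp [envComul_ι, -UniversalEnvelopingAlgebra.ι_apply, add_comm]
    exact congrArg AlgHom.toLinearMap h

/-- The morphism of enveloping algebras induced by a morphism of Lie algebras. -/
def envMap {M : Type*} [LieRing M] [LieAlgebra k M] (f : L →ₗ⁅k⁆ M) :
    UniversalEnvelopingAlgebra k L →ₐ[k] UniversalEnvelopingAlgebra k M :=
  UniversalEnvelopingAlgebra.lift k ((UniversalEnvelopingAlgebra.ι k).comp f)

lemma envMap_ι {M : Type*} [LieRing M] [LieAlgebra k M] (f : L →ₗ⁅k⁆ M) (x : L) :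
    envMap f (UniversalEnvelopingAlgebra.ι k x) = UniversalEnvelopingAlgebra.ι k (f x) := by
  rw [envMap, UniversalEnvelopingAlgebra.lift_ι_apply]
  rfl

lemma comul_envMap {M : Type*} [LieRing M] [LieAlgebra k M] (f : L →ₗ⁅k⁆ M)
    (u : UniversalEnvelopingAlgebra k L) :
    Coalgebra.comul (R := k) (envMap f u) =
      TensorProduct.map (envMap f).toLinearMap (envMap f).toLinearMap (Coalgebra.comul u) := by
  have h : (envComul k M).comp (envMap f) =
      (Algebra.TensorProduct.map (envMap f) (envMap f)).comp (envComul k L) :=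
    env_hom_ext fun x => by
      simp [envComul_ι, envMap_ι, -UniversalEnvelopingAlgebra.ι_apply]
  exact DFunLike.congr_fun h u

lemma counit_envMap {M : Type*} [LieRing M] [LieAlgebra k M] (f : L →ₗ⁅k⁆ M)
    (u : UniversalEnvelopingAlgebra k L) :
    Coalgebra.counit (R := k) (envMap f u) = Coalgebra.counit (R := k) u := by
  have h : (envCounit k M).comp (envMap f) = envCounit k L :=
    env_hom_ext fun x => by
      simp [envCounit_ι, envMap_ι, -UniversalEnvelopingAlgebra.ι_apply]
  exact DFunLike.congr_fun h u

lemma adjoin_ι : Algebra.adjoin k (Set.range (UniversalEnvelopingAlgebra.ι k (L := L))) = ⊤ := by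
  set S := Algebra.adjoin k (Set.range (UniversalEnvelopingAlgebra.ι k (L := L)))
  let j : L →ₗ⁅k⁆ S :=
    { toFun := fun x => ⟨UniversalEnvelopingAlgebra.ι k x, Algebra.subset_adjoin ⟨x, rfl⟩⟩
      map_add' := fun x y => Subtype.ext (map_add _ x y)
      map_smul' := fun c x => Subtype.ext (map_smul _ c x)
      map_lie' := fun {x y} => Subtype.ext (LieHom.map_lie _ x y) }
  have h : S.val.comp (UniversalEnvelopingAlgebra.lift k j) = AlgHom.id k _ :=
    env_hom_ext fun x => by
      rw [AlgHom.comp_apply, UniversalEnvelopingAlgebra.lift_ι_apply]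
      rfl
  refine top_le_iff.mp fun u _ => ?_
  have := DFunLike.congr_fun h u
  simp only [AlgHom.comp_apply, AlgHom.id_apply] at this
  rw [← this]
  exact (UniversalEnvelopingAlgebra.lift k j u).2

lemma top_eq_one_sup : (⊤ : Submodule k (UniversalEnvelopingAlgebra k L)) ≤
    1 ⊔ ⊤ * LinearMap.range (UniversalEnvelopingAlgebra.ι k : L →ₗ⁅k⁆ _).toLinearMap := by
  set T := 1 ⊔ ⊤ * LinearMap.range (UniversalEnvelopingAlgebra.ι k : L →ₗ⁅k⁆ _).toLinearMap
  have key : ∀ u ∈ Algebra.adjoin k (Set.range (UniversalEnvelopingAlgebra.ι k (L := L))),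
      ∀ t ∈ T, t * u ∈ T := by
    intro u hu
    induction hu using Algebra.adjoin_induction with
    | mem u hu =>
      obtain ⟨x, rfl⟩ := hu
      exact fun t _ => Submodule.mem_sup_right
        (Submodule.mul_mem_mul Submodule.mem_top ⟨x, rfl⟩)
    | algebraMap r =>
      intro t ht
      rw [← Algebra.commutes, ← Algebra.smul_def]
      exact T.smul_mem r ht
    | add a b _ _ ha hb =>
      intro t ht
      rw [mul_add]
      exact T.add_mem (ha t ht) (hb t ht)
    | mul a b _ _ ha hb =>
      intro t ht
      rw [← mul_assoc]
      exact hb _ (ha t ht)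
  intro u _
  have := key u (by rw [adjoin_ι]; trivial) 1
    (Submodule.mem_sup_left (Submodule.one_le.mp le_rfl))
  rwa [one_mul] at this


variable (k L) in
/-- A decreasing filtration `L = F 1 ⊇ F 2 ⊇ ⋯` of a Lie algebra by subspaces, with
`⁅F i, F j⁆ ⊆ F (i + j)`.  The index starts at `1`; by convention `F 0 = L` too, which is forced
by antitonicity and consistent with the bracket condition. -/
structure LieFiltration where
  /-- the subspaces of the filtration -/
  F : ℕ → Submodule k L
  antitone' : Antitone F
  one_eq_top : F 1 = ⊤
  lie_mem' : ∀ i j : ℕ, ∀ x ∈ F i, ∀ y ∈ F j, ⁅x, y⁆ ∈ F (i + j)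

/-- The filtration of the enveloping algebra of a filtered Lie algebra: `F^0` is everything, `F^1`
is the augmentation ideal `U_+`, and `F^(q+1) = F^q · U_+ + (L^(q+1))`, where `(L^(q+1))` is the
two-sided ideal generated by the `(q+1)`-st term of the filtration of the Lie algebra. (For `q = 0`
this recursion gives `F^1 = U_+`, see `envFil_one`.)  Products are products of subspaces. -/
def LieFiltration.envFil (φ : LieFiltration k L) :
    ℕ → Submodule k (UniversalEnvelopingAlgebra k L)
  | 0 => ⊤
  | q + 1 => LieFiltration.envFil φ q *
        LinearMap.ker (Coalgebra.counit (R := k) (A := UniversalEnvelopingAlgebra k L)) ⊔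
      ⊤ * (φ.F (q + 1)).map (UniversalEnvelopingAlgebra.ι k : L →ₗ⁅k⁆ _).toLinearMap * ⊤

namespace LieFiltration

lemma F_zero (φ : LieFiltration k L) : φ.F 0 = ⊤ :=
  top_le_iff.mp (φ.one_eq_top ▸ φ.antitone' (Nat.zero_le 1))

/-- Each term of the filtration is an ideal. -/
def ideal (φ : LieFiltration k L) (n : ℕ) : LieIdeal k L :=
  { φ.F n with
    lie_mem := fun {x m} hm => by
      have := φ.lie_mem' 0 n x (by rw [φ.F_zero]; trivial) m hm
      rwa [zero_add] at this }

/-- The quotient Lie algebra `L_p = L / L^(p+1)`. -/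
abbrev Quo (φ : LieFiltration k L) (p : ℕ) : Type _ := L ⧸ φ.ideal (p + 1)

/-- The projection `L → L_p`, a morphism of Lie algebras. -/
def proj (φ : LieFiltration k L) (p : ℕ) : L →ₗ⁅k⁆ φ.Quo p :=
  { (φ.ideal (p + 1)).toSubmodule.mkQ with map_lie' := fun {_ _} => rfl }

lemma proj_surjective (φ : LieFiltration k L) (p : ℕ) : Function.Surjective (φ.proj p) :=
  Submodule.mkQ_surjective _

/-- The induced filtration of `L_p`, by the images of the terms of the filtration of `L`. -/
def quo (φ : LieFiltration k L) (p : ℕ) : LieFiltration k (φ.Quo p) where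
  F i := (φ.F i).map (φ.proj p).toLinearMap
  antitone' _ _ h := Submodule.map_mono (φ.antitone' h)
  one_eq_top := by
    rw [φ.one_eq_top, Submodule.map_top, LinearMap.range_eq_top]
    exact φ.proj_surjective p
  lie_mem' := by
    rintro i j _ ⟨x, hx, rfl⟩ _ ⟨y, hy, rfl⟩
    exact ⟨⁅x, y⁆, φ.lie_mem' i j x hx y hy, LieHom.map_lie (φ.proj p) x y⟩

/-- The transition map `L_q → L_p` for `p ≤ q`. -/
def trans (φ : LieFiltration k L) {p q : ℕ} (h : p ≤ q) : φ.Quo q →ₗ⁅k⁆ φ.Quo p :=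
  { Submodule.mapQ (φ.ideal (q + 1)).toSubmodule (φ.ideal (p + 1)).toSubmodule LinearMap.id
      (φ.antitone' (Nat.succ_le_succ h)) with
    map_lie' := by
      intro x y
      obtain ⟨x, rfl⟩ := φ.proj_surjective q x
      obtain ⟨y, rfl⟩ := φ.proj_surjective q y
      rfl }

lemma trans_proj (φ : LieFiltration k L) {p q : ℕ} (h : p ≤ q) (x : L) :
    φ.trans h (φ.proj q x) = φ.proj p x := rfl

/-- `L` is complete for the filtration: the canonical map from `L` to the inverse limit of the
`L_p` is bijective, that is, every compatible family comes from a unique element of `L`. -/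
def IsComplete (φ : LieFiltration k L) : Prop :=
  ∀ x : ∀ p, φ.Quo p, (∀ p q (h : p ≤ q), φ.trans h (x q) = x p) → ∃! y : L, ∀ p, φ.proj p y = x p

section envFil

variable (φ : LieFiltration k L)

lemma envFil_ideal_le (n : ℕ) :
    ⊤ * (φ.F n).map (UniversalEnvelopingAlgebra.ι k : L →ₗ⁅k⁆ _).toLinearMap * ⊤ ≤
      φ.envFil n := by
  cases n with
  | zero => exact le_top
  | succ n => exact le_sup_right

lemma counit_ker_mul_top :
    LinearMap.ker (Coalgebra.counit (R := k) (A := UniversalEnvelopingAlgebra k L)) * ⊤ ≤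
      LinearMap.ker (Coalgebra.counit (R := k) (A := UniversalEnvelopingAlgebra k L)) := by
  rw [Submodule.mul_le]
  intro a ha b _
  rw [LinearMap.mem_ker] at ha ⊢
  rw [Bialgebra.counit_mul, ha, zero_mul]

lemma top_mul_counit_ker :
    ⊤ * LinearMap.ker (Coalgebra.counit (R := k) (A := UniversalEnvelopingAlgebra k L)) ≤
      LinearMap.ker (Coalgebra.counit (R := k) (A := UniversalEnvelopingAlgebra k L)) := by
  rw [Submodule.mul_le]
  intro b _ a ha
  rw [LinearMap.mem_ker] at ha ⊢
  rw [Bialgebra.counit_mul, ha, mul_zero]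

lemma envFil_mul_top (n : ℕ) : φ.envFil n * ⊤ ≤ φ.envFil n := by
  cases n with
  | zero => exact le_top
  | succ n =>
    rw [envFil, Submodule.sup_mul]
    refine sup_le_sup ?_ ?_
    · rw [mul_assoc]
      gcongr
      exact counit_ker_mul_top
    · rw [mul_assoc]
      gcongr
      exact le_top

lemma top_mul_envFil (n : ℕ) : ⊤ * φ.envFil n ≤ φ.envFil n := by
  induction n with
  | zero => exact le_top
  | succ n ih =>
    rw [envFil, Submodule.mul_sup]
    refine sup_le_sup ?_ ?_
    · rw [← mul_assoc]
      gcongr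
    · rw [← mul_assoc, ← mul_assoc]
      gcongr
      exact le_top

lemma envFil_one : φ.envFil 1 =
    LinearMap.ker (Coalgebra.counit (R := k) (A := UniversalEnvelopingAlgebra k L)) := by
  apply le_antisymm
  · rw [envFil]
    refine sup_le (by rw [envFil]; exact top_mul_counit_ker) ?_
    refine le_trans ?_ counit_ker_mul_top
    gcongr
    refine le_trans ?_ top_mul_counit_ker
    gcongr
    rintro _ ⟨x, -, rfl⟩
    exact counit_ι x
  · refine le_trans ?_ le_sup_left
    rw [envFil]
    intro a ha
    rw [← one_mul a]
    exact Submodule.mul_mem_mul Submodule.mem_top ha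

lemma envFil_succ_le (n : ℕ) : φ.envFil (n + 1) ≤ φ.envFil n := by
  conv_lhs => rw [envFil]
  refine sup_le ?_ ?_
  · refine le_trans ?_ (φ.envFil_mul_top n)
    gcongr
    exact le_top
  · refine le_trans ?_ (φ.envFil_ideal_le n)
    gcongr
    exact φ.antitone' (Nat.le_succ n)

lemma envFil_antitone : Antitone φ.envFil := antitone_nat_of_succ_le φ.envFil_succ_le

lemma counit_ker_pow_le (n : ℕ) :
    LinearMap.ker (Coalgebra.counit (R := k) (A := UniversalEnvelopingAlgebra k L)) ^ n ≤
      φ.envFil n := by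
  induction n with
  | zero => exact le_top
  | succ n ih =>
    rw [pow_succ, envFil]
    exact le_trans (by gcongr) le_sup_left

lemma envFil_map {M : Type*} [LieRing M] [LieAlgebra k M] (ψ : LieFiltration k M) (g : L →ₗ⁅k⁆ M)
    (hg : ∀ i, ∀ x ∈ φ.F i, g x ∈ ψ.F i) (n : ℕ) :
    (φ.envFil n).map (envMap g).toLinearMap ≤ ψ.envFil n := by
  induction n with
  | zero => exact le_top
  | succ n ih =>
    conv_lhs => rw [envFil]
    rw [envFil, Submodule.map_sup, Submodule.map_mul, Submodule.map_mul, Submodule.map_mul]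
    refine sup_le_sup ?_ ?_
    · gcongr
      rintro _ ⟨u, hu, rfl⟩
      exact (counit_envMap g u).trans hu
    · gcongr
      · exact le_top
      · rintro _ ⟨_, ⟨x, hx, rfl⟩, rfl⟩
        exact ⟨g x, hg _ x hx, (envMap_ι g x).symm⟩
      · exact le_top

/-- If the Lie algebra is finite-dimensional, so are the quotients of the enveloping algebra. -/
lemma exists_fg_sup_envFil [FiniteDimensional k L] (n : ℕ) :
    ∃ W : Submodule k (UniversalEnvelopingAlgebra k L), W.FG ∧ ⊤ ≤ W ⊔ φ.envFil n := by
  induction n with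
  | zero => exact ⟨⊥, Submodule.fg_bot, le_sup_right⟩
  | succ n ih =>
    obtain ⟨W, hW, h⟩ := ih
    refine ⟨1 ⊔ W * LinearMap.range (UniversalEnvelopingAlgebra.ι k : L →ₗ⁅k⁆ _).toLinearMap,
      Submodule.FG.sup ?_ (hW.mul ?_), ?_⟩
    · rw [Submodule.one_eq_span]
      exact Submodule.fg_span_singleton _
    · rw [LinearMap.range_eq_map]
      exact (Module.Finite.fg_top (R := k) (M := L)).map _
    · refine top_eq_one_sup.trans (sup_le (le_sup_of_le_left le_sup_left) ?_)
      refine le_trans (b := (W ⊔ φ.envFil n) *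
        LinearMap.range (UniversalEnvelopingAlgebra.ι k : L →ₗ⁅k⁆ _).toLinearMap)
        (by gcongr) ?_
      rw [Submodule.sup_mul]
      refine sup_le_sup le_sup_right ?_
      rw [envFil]
      refine le_trans ?_ le_sup_left
      gcongr
      rintro _ ⟨x, rfl⟩
      exact counit_ι x

end envFil
section DualAlgebra

open WithConv

/-- The convolution of two functionals, on a product. -/
lemma conv_mul_right (f g : UniversalEnvelopingAlgebra k L →ₗ[k] k)
    (x u : UniversalEnvelopingAlgebra k L) {ι : Type*} (r : Coalgebra.Repr k u ι) :
    (toConv f * toConv g) (x * u) = ∑ i ∈ r.index,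
      (toConv (f ∘ₗ LinearMap.mulRight k (r.left i)) *
        toConv (g ∘ₗ LinearMap.mulRight k (r.right i))) x := by
  simp only [LinearMap.convMul_apply, Bialgebra.comul_mul]
  rw [← r.eq, ← (Coalgebra.Repr.arbitrary k x).eq, Finset.sum_mul_sum, map_sum, map_sum]
  simp only [map_sum, Algebra.TensorProduct.tmul_mul_tmul, TensorProduct.map_tmul,
    LinearMap.mul'_apply, LinearMap.comp_apply, LinearMap.mulRight_apply]
  exact Finset.sum_comm

lemma conv_vanish (φ : LieFiltration k L) (n : ℕ) :
    ∀ (a b : ℕ), a + b = n → ∀ f g : UniversalEnvelopingAlgebra k L →ₗ[k] k,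
      (∀ u ∈ φ.envFil a, f u = 0) → (∀ u ∈ φ.envFil b, g u = 0) →
      ∀ u ∈ φ.envFil n, (toConv f * toConv g) u = 0 := by
  induction n with
  | zero =>
    intro a b hab f g hf _ u _
    obtain rfl : a = 0 := by omega
    have : f = 0 := LinearMap.ext fun u => hf u Submodule.mem_top
    subst this
    rw [toConv_zero, zero_mul]
    rfl
  | succ n ih =>
    intro a b hab f g hf hg
    rcases a with _ | a
    · intro u _
      have : f = 0 := LinearMap.ext fun u => hf u Submodule.mem_top
      subst this
      rw [toConv_zero, zero_mul]
      rfl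
    rcases b with _ | b
    · intro u _
      have : g = 0 := LinearMap.ext fun u => hg u Submodule.mem_top
      subst this
      rw [toConv_zero, mul_zero]
      rfl
    have hmul : ∀ (c : ℕ) (h : UniversalEnvelopingAlgebra k L →ₗ[k] k),
        (∀ u ∈ φ.envFil (c + 1), h u = 0) → ∀ v,
        Coalgebra.counit (R := k) v = (0 : k) →
          ∀ u ∈ φ.envFil c, (h ∘ₗ LinearMap.mulRight k v) u = 0 := by
      intro c h hh v hv u hu
      refine hh _ ?_
      rw [envFil]
      exact Submodule.mem_sup_left (Submodule.mul_mem_mul hu hv)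
    have hmul' : ∀ (c : ℕ) (h : UniversalEnvelopingAlgebra k L →ₗ[k] k),
        (∀ u ∈ φ.envFil c, h u = 0) → ∀ v,
          ∀ u ∈ φ.envFil c, (h ∘ₗ LinearMap.mulRight k v) u = 0 := by
      intro c h hh v u hu
      exact hh _ (φ.envFil_mul_top c (Submodule.mul_mem_mul hu Submodule.mem_top))
    suffices hle : φ.envFil (n + 1) ≤ LinearMap.ker (toConv f * toConv g).ofConv from
      fun u hu => hle hu
    rw [envFil]
    refine sup_le ?_ ?_
    · rw [Submodule.mul_le]
      intro x hx u hu
      rw [LinearMap.mem_ker] at hu ⊢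
      change (toConv f * toConv g) (x * u) = 0
      let r := Coalgebra.Repr.arbitrary k u
      rw [conv_mul_right f g x u r]
      have h1 : ∀ i ∈ r.index, (toConv (f ∘ₗ LinearMap.mulRight k (r.left i)) *
          toConv (g ∘ₗ LinearMap.mulRight k (r.right i))) x =
          (toConv f * toConv (g ∘ₗ LinearMap.mulRight k
            (Coalgebra.counit (R := k) (r.left i) • r.right i))) x := by
        intro i _
        have := ih a (b + 1) (by omega)
          (f ∘ₗ LinearMap.mulRight k (r.left i -
            algebraMap k _ (Coalgebra.counit (R := k) (r.left i))))
          (g ∘ₗ LinearMap.mulRight k (r.right i))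
          (hmul a f hf _ (by simp)) (hmul' (b + 1) g hg _) x hx
        rw [← sub_eq_zero, ← this]
        have e1 : f ∘ₗ LinearMap.mulRight k (r.left i -
            algebraMap k _ (Coalgebra.counit (R := k) (r.left i))) =
            f ∘ₗ LinearMap.mulRight k (r.left i) -
              (Coalgebra.counit (R := k) (r.left i)) • f := by
          ext u
          simp [mul_sub, ← Algebra.commutes, ← Algebra.smul_def]
        have e2 : g ∘ₗ LinearMap.mulRight k
            (Coalgebra.counit (R := k) (r.left i) • r.right i) =
            (Coalgebra.counit (R := k) (r.left i)) •
              (g ∘ₗ LinearMap.mulRight k (r.right i)) := by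
          ext u
          simp
        rw [e1, e2, toConv_sub, sub_mul, toConv_smul, toConv_smul, smul_mul_assoc,
          mul_smul_comm]
        rfl
      rw [Finset.sum_congr rfl h1]
      have h2 : ∑ i ∈ r.index, (toConv f * toConv (g ∘ₗ LinearMap.mulRight k
            (Coalgebra.counit (R := k) (r.left i) • r.right i))) x =
          (toConv f * toConv (g ∘ₗ LinearMap.mulRight k u)) x := by
        have e : g ∘ₗ LinearMap.mulRight k u = ∑ i ∈ r.index, g ∘ₗ LinearMap.mulRight k
            (Coalgebra.counit (R := k) (r.left i) • r.right i) := by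
          ext v
          conv_lhs => rw [← Coalgebra.sum_counit_smul r]
          simp [Finset.mul_sum]
        rw [e]
        simp only [LinearMap.convMul_apply]
        rw [← (Coalgebra.Repr.arbitrary k x).eq]
        simp only [map_sum, TensorProduct.map_tmul, LinearMap.mul'_apply,
          LinearMap.sum_apply, Finset.mul_sum]
        exact Finset.sum_comm
      rw [h2]
      exact ih (a + 1) b (by omega) f _ hf (hmul b g hg u hu) x hx
    · rw [Submodule.mul_le]
      intro y hy d _
      revert y
      suffices ⊤ * (φ.F (n + 1)).map (UniversalEnvelopingAlgebra.ι k : L →ₗ⁅k⁆ _).toLinearMap ≤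
          (LinearMap.ker (toConv f * toConv g).ofConv).comap (LinearMap.mulRight k d) from
        fun y hy => this hy
      rw [Submodule.mul_le]
      rintro c - _ ⟨l, hl, rfl⟩
      have hmem : ∀ m ≤ n + 1, ∀ p q : UniversalEnvelopingAlgebra k L,
          p * UniversalEnvelopingAlgebra.ι k l * q ∈ φ.envFil m := fun m hm p q =>
        φ.envFil_antitone hm (φ.envFil_ideal_le (n + 1) (Submodule.mul_mem_mul
          (Submodule.mul_mem_mul Submodule.mem_top ⟨l, hl, rfl⟩) Submodule.mem_top))
      change (toConv f * toConv g) (c * UniversalEnvelopingAlgebra.ι k l * d) = 0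
      rw [LinearMap.convMul_apply, Bialgebra.comul_mul, Bialgebra.comul_mul, comul_ι,
        ← (Coalgebra.Repr.arbitrary k c).eq, ← (Coalgebra.Repr.arbitrary k d).eq]
      simp only [Finset.sum_mul, Finset.mul_sum, mul_add, add_mul,
        Algebra.TensorProduct.tmul_mul_tmul, map_sum, map_add, TensorProduct.map_tmul,
        LinearMap.mul'_apply, mul_one]
      refine Finset.sum_eq_zero fun i _ => ?_
      rw [← Finset.sum_add_distrib]
      refine Finset.sum_eq_zero fun j _ => ?_
      rw [hf _ (hmem _ (by omega) _ _), hg _ (hmem _ (by omega) _ _)]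
      simp

end DualAlgebra
section Duals

open WithConv

variable (φ : LieFiltration k L)

/-- The finite stage `K^p = Hom(L_p, k)`, as a space of functionals on `L`, embedded by the
transpose of the surjection `L → L_p`. -/
def KStage (p : ℕ) : Submodule k (Module.Dual k L) :=
  LinearMap.range (φ.proj p).toLinearMap.dualMap

lemma KStage_mono {p q : ℕ} (h : p ≤ q) : φ.KStage p ≤ φ.KStage q := by
  rintro _ ⟨g, rfl⟩
  exact ⟨g ∘ₗ (φ.trans h).toLinearMap, rfl⟩

/-- The dual Lie coalgebra `K`, the direct limit of the `K^p`.  The transition maps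
`K^p → K^(p+1)` are the transposes of the surjections `L_(p+1) → L_p`, hence injective, so the
direct limit is the union of the increasing subspaces `K^p` of the dual of `L`. -/
def K : Submodule k (Module.Dual k L) where
  carrier := {f | ∃ p, f ∈ φ.KStage p}
  add_mem' := by
    rintro f g ⟨p, hf⟩ ⟨q, hg⟩
    exact ⟨max p q, Submodule.add_mem _ (φ.KStage_mono (le_max_left p q) hf)
      (φ.KStage_mono (le_max_right p q) hg)⟩
  zero_mem' := ⟨0, Submodule.zero_mem _⟩
  smul_mem' := by
    rintro c f ⟨p, hf⟩
    exact ⟨p, Submodule.smul_mem _ c hf⟩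

/-- The surjection `U(L) → U(L_p) → U^j(L_p) = U(L_p) / F^(j+1) U(L_p)`. -/
def envQuo (p j : ℕ) : UniversalEnvelopingAlgebra k L →ₗ[k]
    UniversalEnvelopingAlgebra k (φ.Quo p) ⧸ (φ.quo p).envFil (j + 1) :=
  ((φ.quo p).envFil (j + 1)).mkQ ∘ₗ (envMap (φ.proj p)).toLinearMap

/-- The finite stage `U^c_j(K^p) = Hom(U^j(L_p), k)`, as a space of functionals on `U(L)`, embedded
by the transpose of the surjection `U(L) → U^j(L_p)`. -/
def UcStage (p j : ℕ) : Submodule k (Module.Dual k (UniversalEnvelopingAlgebra k L)) :=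
  LinearMap.range (φ.envQuo p j).dualMap

variable {φ}

lemma mem_UcStage {p j : ℕ} {f : Module.Dual k (UniversalEnvelopingAlgebra k L)} :
    f ∈ φ.UcStage p j ↔ ∃ g : UniversalEnvelopingAlgebra k (φ.Quo p) →ₗ[k] k,
      (∀ u ∈ (φ.quo p).envFil (j + 1), g u = 0) ∧ f = g ∘ₗ (envMap (φ.proj p)).toLinearMap := by
  constructor
  · rintro ⟨h, rfl⟩
    refine ⟨h ∘ₗ ((φ.quo p).envFil (j + 1)).mkQ, fun u hu => ?_, rfl⟩
    rw [LinearMap.comp_apply, Submodule.mkQ_apply, (Submodule.Quotient.mk_eq_zero _).mpr hu,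
      map_zero]
  · rintro ⟨g, hg, rfl⟩
    exact ⟨Submodule.liftQ _ g hg, rfl⟩

lemma UcStage_mono {p q i j : ℕ} (hp : p ≤ q) (hj : i ≤ j) : φ.UcStage p i ≤ φ.UcStage q j := by
  intro f hf
  obtain ⟨g, hg, rfl⟩ := mem_UcStage.mp hf
  refine mem_UcStage.mpr ⟨g ∘ₗ (envMap (φ.trans hp)).toLinearMap, fun u hu => hg _ ?_, ?_⟩
  · refine (φ.quo q).envFil_map (φ.quo p) (φ.trans hp) ?_ (i + 1)
      ⟨u, (φ.quo q).envFil_antitone (Nat.succ_le_succ hj) hu, rfl⟩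
    rintro n _ ⟨x, hx, rfl⟩
    exact ⟨x, hx, rfl⟩
  · have : envMap (φ.proj p) = (envMap (φ.trans hp)).comp (envMap (φ.proj q)) :=
      env_hom_ext fun x => by
        rw [AlgHom.comp_apply, envMap_ι, envMap_ι, envMap_ι, trans_proj]
    rw [this]
    rfl

lemma mul_mem_UcStage {p i j : ℕ} {f g : Module.Dual k (UniversalEnvelopingAlgebra k L)}
    (hf : f ∈ φ.UcStage p i) (hg : g ∈ φ.UcStage p j) :
    (toConv f * toConv g).ofConv ∈ φ.UcStage p (i + j + 1) := by
  obtain ⟨f', hf', rfl⟩ := mem_UcStage.mp hf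
  obtain ⟨g', hg', rfl⟩ := mem_UcStage.mp hg
  refine mem_UcStage.mpr ⟨(toConv f' * toConv g').ofConv,
    conv_vanish (φ.quo p) _ (i + 1) (j + 1) (by omega) f' g' hf' hg', ?_⟩
  ext u
  change (toConv (f' ∘ₗ (envMap (φ.proj p)).toLinearMap) *
    toConv (g' ∘ₗ (envMap (φ.proj p)).toLinearMap)) u =
      (toConv f' * toConv g') (envMap (φ.proj p) u)
  rw [LinearMap.convMul_apply, LinearMap.convMul_apply, comul_envMap,
    ← (Coalgebra.Repr.arbitrary k u).eq]
  simp

variable (φ) in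
/-- `U^c(K)`, the direct limit of the `U^c_j(K^p)` over `j` and `p`, as a subalgebra of the
convolution algebra of functionals on `U(L)`.  The transition maps are transposes of surjections,
hence injective, so the direct limit is the union of the subspaces `U^c_j(K^p)` of the dual of
`U(L)`.  The product is the shuffle product, i.e. the dual of the shuffle coproduct `Δ` of the
enveloping algebra: `(f * g)(u) = (f ⊗ g)(Δ u)`; the unit is the counit of the enveloping
algebra. -/
def ucSubalgebra : Subalgebra k (WithConv (UniversalEnvelopingAlgebra k L →ₗ[k] k)) where
  carrier := {f | ∃ p j, f.ofConv ∈ φ.UcStage p j}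
  mul_mem' := by
    rintro f g ⟨p, i, hf⟩ ⟨q, j, hg⟩
    exact ⟨max p q, i + j + 1, mul_mem_UcStage (UcStage_mono (le_max_left p q) le_rfl hf)
      (UcStage_mono (le_max_right p q) le_rfl hg)⟩
  add_mem' := by
    rintro f g ⟨p, i, hf⟩ ⟨q, j, hg⟩
    exact ⟨max p q, max i j, Submodule.add_mem _
      (UcStage_mono (le_max_left p q) (le_max_left i j) hf)
      (UcStage_mono (le_max_right p q) (le_max_right i j) hg)⟩
  algebraMap_mem' r := by
    refine ⟨0, 0, mem_UcStage.mpr ⟨r • Coalgebra.counit, fun u hu => ?_, ?_⟩⟩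
    · replace hu : Coalgebra.counit (R := k) u = (0 : k) := by
        have h := (φ.quo 0).envFil_one
        exact LinearMap.mem_ker.mp (h ▸ hu)
      rw [LinearMap.smul_apply, hu, smul_zero]
    · ext u
      change r • _ = r • Coalgebra.counit (R := k) (envMap (φ.proj 0) u)
      rw [counit_envMap]
      rfl

lemma mem_ucSubalgebra {f : WithConv (UniversalEnvelopingAlgebra k L →ₗ[k] k)} :
    f ∈ φ.ucSubalgebra ↔ ∃ p j, f.ofConv ∈ φ.UcStage p j := Iff.rfl

variable (φ) in
/-- The commutative algebra `U^c(K)`, with the shuffle product. -/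
def Uc : Type _ := φ.ucSubalgebra

instance : CommRing φ.Uc := inferInstanceAs (CommRing φ.ucSubalgebra)

instance : Algebra k φ.Uc := inferInstanceAs (Algebra k φ.ucSubalgebra)

/-- Evaluation of an element of `U^c(K)` on an element of the enveloping algebra. -/
def Uc.eval : φ.Uc →ₗ[k] Module.Dual k (UniversalEnvelopingAlgebra k L) where
  toFun f := f.1.ofConv
  map_add' _ _ := rfl
  map_smul' _ _ := rfl

lemma Uc.eval_injective : Function.Injective (Uc.eval (φ := φ)) :=
  fun _ _ h => Subtype.ext (WithConv.ext h)

variable (φ) in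
/-- The natural map `U^c(K) → K`, the transpose of the inclusion `L → U(L)`. -/
def toK : φ.Uc →ₗ[k] φ.K :=
  LinearMap.codRestrict φ.K
    ((UniversalEnvelopingAlgebra.ι k : L →ₗ⁅k⁆ _).toLinearMap.dualMap ∘ₗ Uc.eval) (by
      rintro ⟨f, p, j, hf⟩
      obtain ⟨g, -, hg⟩ := mem_UcStage.mp hf
      refine ⟨p, g ∘ₗ (UniversalEnvelopingAlgebra.ι k : φ.Quo p →ₗ⁅k⁆ _).toLinearMap, ?_⟩
      ext x
      change g (UniversalEnvelopingAlgebra.ι k (φ.proj p x)) =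
        f.ofConv (UniversalEnvelopingAlgebra.ι k x)
      rw [hg, LinearMap.comp_apply, AlgHom.toLinearMap_apply, envMap_ι])

end Duals
section Coalg

open WithConv

lemma dualDistrib_injective (A B : Type*) [AddCommGroup A] [Module k A] [AddCommGroup B]
    [Module k B] : Function.Injective (TensorProduct.dualDistrib k A B) := by
  rw [injective_iff_map_eq_zero]
  intro t ht
  classical
  let b := Module.Free.chooseBasis k (Module.Dual k A)
  obtain ⟨c, rfl⟩ := TensorProduct.eq_repr_basis_left b t
  have hc : c = 0 := by
    ext i y
    have h1 : ∑ i ∈ c.support, c i y • b i = 0 := by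
      ext x
      have := LinearMap.congr_fun ht (x ⊗ₜ y)
      simp only [Finsupp.sum, map_sum, LinearMap.sum_apply, TensorProduct.dualDistrib_apply,
        LinearMap.zero_apply] at this
      simp only [LinearMap.sum_apply, LinearMap.smul_apply, smul_eq_mul, LinearMap.zero_apply]
      rw [← this]
      exact Finset.sum_congr rfl fun i _ => mul_comm _ _
    by_cases hi : i ∈ c.support
    · exact linearIndependent_iff'.mp b.linearIndependent _ _ h1 i hi
    · rw [Finsupp.notMem_support_iff.mp hi]
      rfl
  rw [hc, Finsupp.sum_zero_index]

variable {φ : LieFiltration k L}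

/-- The pairing of `U^c(K) ⊗ U^c(K)` with `U(L) ⊗ U(L)`. -/
def pair2 : φ.Uc ⊗[k] φ.Uc →ₗ[k]
    Module.Dual k (UniversalEnvelopingAlgebra k L ⊗[k] UniversalEnvelopingAlgebra k L) :=
  TensorProduct.dualDistrib k _ _ ∘ₗ TensorProduct.map Uc.eval Uc.eval

lemma pair2_tmul (f g : φ.Uc) (u v : UniversalEnvelopingAlgebra k L) :
    pair2 (f ⊗ₜ[k] g) (u ⊗ₜ[k] v) = Uc.eval f u * Uc.eval g v := rfl

lemma pair2_injective : Function.Injective (pair2 (φ := φ)) :=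
  (dualDistrib_injective _ _).comp
    (TensorProduct.map_injective_of_flat_flat _ _ Uc.eval_injective Uc.eval_injective)

/-- The pairing of a triple tensor power of `U^c(K)` with that of `U(L)`. -/
def pair3 : φ.Uc ⊗[k] (φ.Uc ⊗[k] φ.Uc) →ₗ[k]
    Module.Dual k (UniversalEnvelopingAlgebra k L ⊗[k]
      (UniversalEnvelopingAlgebra k L ⊗[k] UniversalEnvelopingAlgebra k L)) :=
  TensorProduct.dualDistrib k _ _ ∘ₗ TensorProduct.map Uc.eval pair2

lemma pair3_tmul (f : φ.Uc) (t : φ.Uc ⊗[k] φ.Uc) (u : UniversalEnvelopingAlgebra k L)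
    (v : UniversalEnvelopingAlgebra k L ⊗[k] UniversalEnvelopingAlgebra k L) :
    pair3 (f ⊗ₜ[k] t) (u ⊗ₜ[k] v) = Uc.eval f u * pair2 t v := rfl

lemma pair3_injective : Function.Injective (pair3 (φ := φ)) :=
  (dualDistrib_injective _ _).comp
    (TensorProduct.map_injective_of_flat_flat _ _ Uc.eval_injective pair2_injective)

lemma pair3_assoc_tmul (t : φ.Uc ⊗[k] φ.Uc) (h : φ.Uc) (u v w : UniversalEnvelopingAlgebra k L) :
    pair3 (TensorProduct.assoc k _ _ _ (t ⊗ₜ h)) (u ⊗ₜ (v ⊗ₜ w)) =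
      pair2 t (u ⊗ₜ v) * Uc.eval h w := by
  induction t with
  | zero => simp
  | tmul f g =>
    rw [TensorProduct.assoc_tmul, pair3_tmul, pair2_tmul, pair2_tmul, mul_assoc]
  | add s t hs ht => simp only [TensorProduct.add_tmul, map_add, LinearMap.add_apply, hs, ht,
      add_mul]

/-- Restriction of a functional along the multiplication of `U(L)`. -/
def dualMul : Module.Dual k (UniversalEnvelopingAlgebra k L) →ₗ[k]
    Module.Dual k (UniversalEnvelopingAlgebra k L ⊗[k] UniversalEnvelopingAlgebra k L) :=
  (LinearMap.mul' k (UniversalEnvelopingAlgebra k L)).dualMap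

lemma dualMul_tmul (f : Module.Dual k (UniversalEnvelopingAlgebra k L))
    (u v : UniversalEnvelopingAlgebra k L) : dualMul f (u ⊗ₜ v) = f (u * v) := rfl

/-- A functional vanishing on `F^(j+1)` of a finite-dimensional filtered Lie algebra has a finite
coproduct. -/
lemma exists_coproduct {M : Type*} [LieRing M] [LieAlgebra k M] [FiniteDimensional k M]
    (ψ : LieFiltration k M) (n : ℕ) (g : UniversalEnvelopingAlgebra k M →ₗ[k] k)
    (hg : ∀ u ∈ ψ.envFil n, g u = 0) :
    ∃ (m : ℕ) (a b : Fin m → UniversalEnvelopingAlgebra k M →ₗ[k] k),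
      (∀ i, ∀ u ∈ ψ.envFil n, a i u = 0) ∧ (∀ i, ∀ u ∈ ψ.envFil n, b i u = 0) ∧
      ∀ u v, g (u * v) = ∑ i, a i u * b i v := by
  obtain ⟨W, hW, hWF⟩ := ψ.exists_fg_sup_envFil n
  have : FiniteDimensional k (UniversalEnvelopingAlgebra k M ⧸ ψ.envFil n) := by
    refine ⟨?_⟩
    have h : (⊤ : Submodule k (UniversalEnvelopingAlgebra k M ⧸ ψ.envFil n)) =
        W.map (ψ.envFil n).mkQ := by
      refine le_antisymm (fun x _ => ?_) le_top
      obtain ⟨u, rfl⟩ := Submodule.mkQ_surjective _ x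
      obtain ⟨w, hw, y, hy, rfl⟩ := Submodule.mem_sup.mp (hWF (Submodule.mem_top (x := u)))
      refine ⟨w, hw, ?_⟩
      rw [map_add, Submodule.mkQ_apply _ y, (Submodule.Quotient.mk_eq_zero _).mpr hy, add_zero]
    rw [h]
    exact hW.map _
  let T : (UniversalEnvelopingAlgebra k M ⧸ ψ.envFil n) →ₗ[k]
      Module.Dual k (UniversalEnvelopingAlgebra k M) :=
    Submodule.liftQ _ ((LinearMap.mul k _).compr₂ g) (fun u hu => by
      rw [LinearMap.mem_ker]
      ext v
      exact hg _ (ψ.envFil_mul_top n (Submodule.mul_mem_mul hu Submodule.mem_top)))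
  let β := Module.finBasis k (UniversalEnvelopingAlgebra k M ⧸ ψ.envFil n)
  refine ⟨_, fun i => β.coord i ∘ₗ (ψ.envFil n).mkQ, fun i => T (β i), fun i u hu => ?_,
    fun i u hu => ?_, fun u v => ?_⟩
  · rw [LinearMap.comp_apply, Submodule.mkQ_apply, (Submodule.Quotient.mk_eq_zero _).mpr hu,
      map_zero]
  · obtain ⟨w, hw⟩ := Submodule.mkQ_surjective _ (β i)
    change T (β i) u = 0
    rw [← hw]
    exact hg _ (ψ.top_mul_envFil n (Submodule.mul_mem_mul Submodule.mem_top hu))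
  · have h : T ((ψ.envFil n).mkQ u) v = g (u * v) := rfl
    rw [← h, ← β.sum_repr ((ψ.envFil n).mkQ u), map_sum, LinearMap.sum_apply]
    simp

variable [∀ p, FiniteDimensional k (φ.Quo p)]

lemma dualMul_mem_range (f : φ.Uc) :
    dualMul (Uc.eval f) ∈ LinearMap.range (pair2 (φ := φ)) := by
  obtain ⟨f, p, j, hf⟩ := f
  obtain ⟨g, hg, hfg⟩ := mem_UcStage.mp hf
  obtain ⟨m, a, b, ha, hb, hab⟩ := exists_coproduct (φ.quo p) (j + 1) g hg
  let a' : Fin m → φ.Uc := fun i => ⟨toConv (a i ∘ₗ (envMap (φ.proj p)).toLinearMap), p, j,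
    mem_UcStage.mpr ⟨a i, ha i, rfl⟩⟩
  let b' : Fin m → φ.Uc := fun i => ⟨toConv (b i ∘ₗ (envMap (φ.proj p)).toLinearMap), p, j,
    mem_UcStage.mpr ⟨b i, hb i, rfl⟩⟩
  refine ⟨∑ i, a' i ⊗ₜ b' i, TensorProduct.ext' fun u v => ?_⟩
  rw [map_sum, LinearMap.sum_apply]
  simp only [pair2_tmul]
  change ∑ i, a i (envMap (φ.proj p) u) * b i (envMap (φ.proj p) v) = f.ofConv (u * v)
  rw [← hab, ← map_mul, hfg]
  rfl

/-- The coproduct of `U^c(K)`, dual to the product of the enveloping algebra: `Δ f` is the unique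
element of `U^c(K) ⊗ U^c(K)` with `⟨Δ f, u ⊗ v⟩ = f (u * v)`, see `pair2_ucComul`. -/
def ucComul : φ.Uc →ₗ[k] φ.Uc ⊗[k] φ.Uc :=
  (LinearEquiv.ofInjective pair2 pair2_injective).symm.toLinearMap ∘ₗ
    LinearMap.codRestrict (LinearMap.range (pair2 (φ := φ))) (dualMul ∘ₗ Uc.eval)
      dualMul_mem_range

lemma pair2_ucComul (f : φ.Uc) (u v : UniversalEnvelopingAlgebra k L) :
    pair2 (ucComul f) (u ⊗ₜ v) = Uc.eval f (u * v) := by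
  have h : pair2 (ucComul f) = dualMul (Uc.eval f) := by
    rw [← LinearEquiv.ofInjective_apply (h := pair2_injective) (f := pair2)]
    simp [ucComul]
  rw [h, dualMul_tmul]

/-- `U^c(K)` as a coalgebra: the coproduct is dual to the product of the enveloping algebra, and the
counit is evaluation at `1`. -/
instance : Coalgebra k φ.Uc where
  comul := ucComul
  counit := LinearMap.applyₗ (1 : UniversalEnvelopingAlgebra k L) ∘ₗ Uc.eval
  coassoc := by
    ext f : 1
    apply pair3_injective
    refine TensorProduct.ext' fun u t => ?_
    induction t with
    | zero => simp
    | add s t hs ht => rw [TensorProduct.tmul_add, map_add, map_add, hs, ht]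
    | tmul v w =>
      have h1 : ∀ t : φ.Uc ⊗[k] φ.Uc,
          pair3 (TensorProduct.assoc k _ _ _ (ucComul.rTensor φ.Uc t)) (u ⊗ₜ (v ⊗ₜ w)) =
            pair2 t ((u * v) ⊗ₜ w) := by
        intro t
        induction t with
        | zero => simp
        | add s t hs ht => simp only [map_add, LinearMap.add_apply, hs, ht]
        | tmul g h =>
          rw [LinearMap.rTensor_tmul, pair3_assoc_tmul, pair2_ucComul, pair2_tmul]
      have h2 : ∀ t : φ.Uc ⊗[k] φ.Uc,
          pair3 (ucComul.lTensor φ.Uc t) (u ⊗ₜ (v ⊗ₜ w)) = pair2 t (u ⊗ₜ (v * w)) := by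
        intro t
        induction t with
        | zero => simp
        | add s t hs ht => simp only [map_add, LinearMap.add_apply, hs, ht]
        | tmul g h =>
          rw [LinearMap.lTensor_tmul, pair3_tmul, pair2_ucComul, pair2_tmul]
      change pair3 (TensorProduct.assoc k _ _ _ (ucComul.rTensor φ.Uc (ucComul f))) _ =
        pair3 (ucComul.lTensor φ.Uc (ucComul f)) _
      rw [h1, h2, pair2_ucComul, pair2_ucComul, mul_assoc]
  rTensor_counit_comp_comul := by
    ext f : 1
    apply (TensorProduct.lid k φ.Uc).injective
    apply Uc.eval_injective
    ext v
    have h : ∀ t : φ.Uc ⊗[k] φ.Uc, Uc.eval (TensorProduct.lid k φ.Uc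
        ((LinearMap.applyₗ (1 : UniversalEnvelopingAlgebra k L) ∘ₗ Uc.eval).rTensor φ.Uc t)) v =
          pair2 t (1 ⊗ₜ v) := by
      intro t
      induction t with
      | zero => simp
      | add s t hs ht => simp only [map_add, LinearMap.add_apply, hs, ht]
      | tmul g h => simp [pair2_tmul]
    simp only [LinearMap.comp_apply, TensorProduct.mk_apply, TensorProduct.lid_tmul, one_smul]
    exact (h _).trans (by rw [pair2_ucComul, one_mul])
  lTensor_counit_comp_comul := by
    ext f : 1
    apply (TensorProduct.rid k φ.Uc).injective
    apply Uc.eval_injective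
    ext v
    have h : ∀ t : φ.Uc ⊗[k] φ.Uc, Uc.eval (TensorProduct.rid k φ.Uc
        ((LinearMap.applyₗ (1 : UniversalEnvelopingAlgebra k L) ∘ₗ Uc.eval).lTensor φ.Uc t)) v =
          pair2 t (v ⊗ₜ 1) := by
      intro t
      induction t with
      | zero => simp
      | add s t hs ht => simp only [map_add, LinearMap.add_apply, hs, ht]
      | tmul g h => simp [pair2_tmul, mul_comm]
    simp only [LinearMap.comp_apply, LinearMap.flip_apply, TensorProduct.mk_apply,
      TensorProduct.rid_tmul, one_smul]
    exact (h _).trans (by rw [pair2_ucComul, mul_one])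

end Coalg
section Euler

open WithConv

variable {φ : LieFiltration k L}

lemma eval_one (u : UniversalEnvelopingAlgebra k L) :
    Uc.eval (1 : φ.Uc) u = Coalgebra.counit u := rfl

lemma eval_mul (f g : φ.Uc) (u : UniversalEnvelopingAlgebra k L) :
    Uc.eval (f * g) u = pair2 (f ⊗ₜ g) (Coalgebra.comul u) := by
  change (f.1 * g.1) u = _
  rw [LinearMap.convMul_apply, ← (Coalgebra.Repr.arbitrary k u).eq]
  simp only [map_sum, TensorProduct.map_tmul, LinearMap.mul'_apply, pair2_tmul]
  rfl

variable [∀ p, FiniteDimensional k (φ.Quo p)]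

lemma eval_counit (f : φ.Uc) : Coalgebra.counit (R := k) f = Uc.eval f 1 := rfl

lemma pair2_comul (f : φ.Uc) (u v : UniversalEnvelopingAlgebra k L) :
    pair2 (Coalgebra.comul (R := k) f) (u ⊗ₜ v) = Uc.eval f (u * v) := pair2_ucComul f u v

/-- Convolution of endomorphisms is compatible with transposition. -/
lemma adjoint_mul {S T : WithConv (φ.Uc →ₗ[k] φ.Uc)}
    {S' T' : WithConv (UniversalEnvelopingAlgebra k L →ₗ[k] UniversalEnvelopingAlgebra k L)}
    (hS : ∀ f u, Uc.eval (S f) u = Uc.eval f (S' u))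
    (hT : ∀ f u, Uc.eval (T f) u = Uc.eval f (T' u)) (f : φ.Uc)
    (u : UniversalEnvelopingAlgebra k L) :
    Uc.eval ((S * T) f) u = Uc.eval f ((S' * T') u) := by
  rw [LinearMap.convMul_apply, LinearMap.convMul_apply,
    ← (Coalgebra.Repr.arbitrary k u).eq]
  simp only [map_sum, TensorProduct.map_tmul, LinearMap.mul'_apply, ← pair2_comul]
  rw [← (Coalgebra.Repr.arbitrary k f).eq]
  simp only [map_sum, TensorProduct.map_tmul, LinearMap.mul'_apply, LinearMap.sum_apply, eval_mul]
  rw [← (Coalgebra.Repr.arbitrary k u).eq]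
  simp only [map_sum, pair2_tmul]
  rw [Finset.sum_comm]
  refine Finset.sum_congr rfl fun i _ => Finset.sum_congr rfl fun j _ => ?_
  rw [← hS, ← hT]

variable (φ) in
/-- `J = id - η ∘ ε`, as an element of the convolution algebra of endomorphisms of `U^c(K)`; the
unit of this algebra is `η ∘ ε`. -/
def J : WithConv (φ.Uc →ₗ[k] φ.Uc) := toConv LinearMap.id - 1

lemma eval_J_pow (n : ℕ) (f : φ.Uc) (u : UniversalEnvelopingAlgebra k L) :
    Uc.eval ((φ.J ^ n) f) u = Uc.eval f (((toConv LinearMap.id - 1 :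
      WithConv (UniversalEnvelopingAlgebra k L →ₗ[k] UniversalEnvelopingAlgebra k L)) ^ n) u) := by
  have h1 : ∀ (f : φ.Uc) (u : UniversalEnvelopingAlgebra k L),
      Uc.eval ((1 : WithConv (φ.Uc →ₗ[k] φ.Uc)) f) u = Uc.eval f ((1 :
        WithConv (UniversalEnvelopingAlgebra k L →ₗ[k] UniversalEnvelopingAlgebra k L)) u) := by
    intro f u
    rw [LinearMap.convOne_apply, LinearMap.convOne_apply, Algebra.algebraMap_eq_smul_one,
      Algebra.algebraMap_eq_smul_one, map_smul, map_smul, LinearMap.smul_apply, eval_one,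
      eval_counit, smul_eq_mul, smul_eq_mul, mul_comm]
  induction n generalizing f u with
  | zero => exact h1 f u
  | succ n ih =>
    rw [pow_succ, pow_succ]
    refine adjoint_mul ih (fun f u => ?_) f u
    change Uc.eval (f - (1 : WithConv (φ.Uc →ₗ[k] φ.Uc)) f) u = Uc.eval f (u - (1 :
      WithConv (UniversalEnvelopingAlgebra k L →ₗ[k] UniversalEnvelopingAlgebra k L)) u)
    rw [map_sub, map_sub, LinearMap.sub_apply, h1]

lemma env_J_pow_mem (n : ℕ) (u : UniversalEnvelopingAlgebra k L) :
    ((toConv LinearMap.id - 1 : WithConv (UniversalEnvelopingAlgebra k L →ₗ[k]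
      UniversalEnvelopingAlgebra k L)) ^ n) u ∈
      LinearMap.ker (Coalgebra.counit (R := k) (A := UniversalEnvelopingAlgebra k L)) ^ n := by
  induction n generalizing u with
  | zero =>
    rw [pow_zero, pow_zero, LinearMap.convOne_apply, Algebra.algebraMap_eq_smul_one]
    exact Submodule.smul_mem _ _ (Submodule.one_le.mp le_rfl)
  | succ n ih =>
    rw [pow_succ, pow_succ, LinearMap.convMul_apply, ← (Coalgebra.Repr.arbitrary k u).eq]
    simp only [map_sum, TensorProduct.map_tmul, LinearMap.mul'_apply]
    refine Submodule.sum_mem _ fun i _ => Submodule.mul_mem_mul (ih _) ?_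
    rw [LinearMap.mem_ker]
    change Coalgebra.counit (R := k) ((Coalgebra.Repr.arbitrary k u).right i -
      algebraMap k (UniversalEnvelopingAlgebra k L)
        (Coalgebra.counit (R := k) ((Coalgebra.Repr.arbitrary k u).right i))) = (0 : k)
    rw [map_sub, Bialgebra.counit_algebraMap, sub_self]

/-- `J` is locally nilpotent for convolution. -/
lemma exists_J_pow_eq_zero (f : φ.Uc) : ∃ N, ∀ n, N ≤ n → (φ.J ^ n) f = 0 := by
  obtain ⟨p, j, hf⟩ := mem_ucSubalgebra.mp f.2
  obtain ⟨g, hg, hfg⟩ := mem_UcStage.mp hf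
  refine ⟨j + 1, fun n hn => Uc.eval_injective ?_⟩
  ext u
  rw [eval_J_pow, map_zero, LinearMap.zero_apply]
  change f.1.ofConv _ = 0
  rw [hfg]
  refine hg _ ((φ.quo p).envFil_antitone hn ((φ.quo p).counit_ker_pow_le n ?_))
  have h : (LinearMap.ker (Coalgebra.counit (R := k)
      (A := UniversalEnvelopingAlgebra k L)) ^ n).map (envMap (φ.proj p)).toLinearMap ≤
      LinearMap.ker (Coalgebra.counit (R := k)
        (A := UniversalEnvelopingAlgebra k (φ.Quo p))) ^ n := by
    rw [Submodule.map_pow]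
    gcongr
    rintro _ ⟨v, hv, rfl⟩
    exact (counit_envMap (φ.proj p) v).trans hv
  exact h ⟨_, env_J_pow_mem n u, rfl⟩

lemma euler_support_finite (f : φ.Uc) :
    (Function.support fun n : ℕ => ((-1) ^ n / (n + 1) : k) • (φ.J ^ (n + 1)) f).Finite := by
  obtain ⟨N, hN⟩ := exists_J_pow_eq_zero f
  refine (Set.finite_lt_nat N).subset fun n hn => ?_
  by_contra h
  refine hn ?_
  change ((-1) ^ n / (n + 1) : k) • (φ.J ^ (n + 1)) f = 0
  rw [hN (n + 1) (by simp only [Set.mem_ofPred_eq] at h; omega), smul_zero]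

variable (φ) in
/-- The Euler idempotent `e = log(id) = J - J⋆J/2 + J⋆J⋆J/3 - ⋯` of `U^c(K)`, the logarithm for
convolution. On each element only finitely many terms are nonzero, see `euler_support_finite`. -/
def euler : φ.Uc →ₗ[k] φ.Uc where
  toFun f := ∑ᶠ n : ℕ, ((-1) ^ n / (n + 1) : k) • (φ.J ^ (n + 1)) f
  map_add' f g := by
    rw [← finsum_add_distrib (euler_support_finite f) (euler_support_finite g)]
    exact finsum_congr fun n => by rw [map_add, smul_add]
  map_smul' c f := by
    rw [RingHom.id_apply, smul_finsum' c (euler_support_finite f)]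
    exact finsum_congr fun n => by rw [map_smul, smul_comm]

variable (φ) in
/-- A linear map `s : K → U^c(K)` is the embedding given by the Euler idempotent if its image is the
image of the Euler idempotent and it is a section of the natural map `U^c(K) → K`. -/
def IsEulerEmbedding (s : φ.K →ₗ[k] φ.Uc) : Prop :=
  LinearMap.range s = LinearMap.range φ.euler ∧ φ.toK ∘ₗ s = LinearMap.id

end Euler

end LieFiltration

end Enveloping

end FilteredLie

end

/-! Elements of `U^c(K)` behave like polynomial functions on `L`. They are functionals on `U(L)`,
and in characteristic zero `U(L)` is spanned by the powers `x ^ n` of elements `x` of `L`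
(`powerSpan_eq_top`). Hence `f` is determined by the series `∑ f(x ^ n) / n! t ^ n`, for `x` in `L`.
The coproduct of `x ^ n` is binomial, so for each `x` the passage to this series is an algebra
morphism from the shuffle product to `k⟦t⟧` (`expSeries`).

Convolution of endomorphisms of `U^c(K)` is transposed to convolution on `U(L)`. There, if an
endomorphism multiplies each `x ^ n` by a scalar `n! aₙ`, it is recorded by the series `∑ aₙ t ^ n`,
and convolution multiplies these series (`ActsBy.mul`). The identity has series `exp t` and `J` has
series `exp t - 1`, so `log⋆` of the identity has series `log (exp t) = t`. Thus `e` is the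
transpose of the map that keeps `x` and kills `x ^ n` for `n ≠ 1` (`eval_euler_pow`). It follows
that `e f` depends only on `π f`, and that `π ∘ e = π`. Once `π` is known to be surjective, this
yields `s`, its uniqueness and `e = s ∘ π`.

The series of `s κ` along `x` is `κ(x) t`, so that of `ψ P` is `P(t x)`. Injectivity of `ψ` holds
because a polynomial over an infinite field is determined by its values. For surjectivity, a
functional in the stage `(p, j)` kills `x ^ n` for `n > j`, and `x ↦ f(x ^ n)` is a homogeneous
polynomial in the coordinates of `L_p`.

Surjectivity of `π` (`toK_surjective`) means that every functional on `L_p` extends to some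
`U^j(L_p)`, for which it is enough that `L_p` embeds into some quotient `U(L_p) / F^n`. This is
proved by induction on dimension: a filtered Lie algebra acts on the enveloping algebra of a
suitable hyperplane, compatibly with a larger filtration by weight (`eq_zero_of_ι_mem_wFil_aux`). -/

noncomputable section

namespace FilteredLie

open scoped TensorProduct

section EulerProof

attribute [local instance] LieRing.ofAssociativeRing

open UniversalEnvelopingAlgebra (ι)

section WeightFiltration

variable {k : Type*} [Field k] {L : Type*} [LieRing L] [LieAlgebra k L]

/-! ### Extension of derivations to the enveloping algebra. -/

section Derivation

variable (δ : L →ₗ[k] L) (hδ : ∀ x y, δ ⁅x, y⁆ = ⁅δ x, y⁆ + ⁅x, δ y⁆)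

/-- For a derivation `δ` of a Lie algebra, the Lie morphism `x ↦ x + ε δ x` to the dual numbers
over the enveloping algebra. -/
def dualNumberLieHom : L →ₗ⁅k⁆ DualNumber (UniversalEnvelopingAlgebra k L) where
  toFun x := TrivSqZeroExt.inl (ι k x) + TrivSqZeroExt.inr (ι k (δ x))
  map_add' x y := by
    ext <;> simp [-UniversalEnvelopingAlgebra.ι_apply]
  map_smul' c x := by
    ext <;> simp [-UniversalEnvelopingAlgebra.ι_apply]
  map_lie' := by
    intro x y
    ext
    · simp [-UniversalEnvelopingAlgebra.ι_apply, LieRing.of_associative_ring_bracket]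
    · simp [-UniversalEnvelopingAlgebra.ι_apply, LieRing.of_associative_ring_bracket, hδ]
      abel

/-- The algebra morphism `u ↦ u + ε D u`, where `D` is the extension of a derivation `δ` of a Lie
algebra to the enveloping algebra. -/
def dualNumberHom : UniversalEnvelopingAlgebra k L →ₐ[k]
    DualNumber (UniversalEnvelopingAlgebra k L) :=
  UniversalEnvelopingAlgebra.lift k (dualNumberLieHom δ hδ)

lemma dualNumberHom_ι (x : L) : dualNumberHom δ hδ (ι k x) =
    TrivSqZeroExt.inl (ι k x) + TrivSqZeroExt.inr (ι k (δ x)) := by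
  rw [dualNumberHom, UniversalEnvelopingAlgebra.lift_ι_apply]
  rfl

lemma fst_dualNumberHom (u : UniversalEnvelopingAlgebra k L) :
    (dualNumberHom δ hδ u).fst = u := by
  have h : (TrivSqZeroExt.fstHom k _ _).comp (dualNumberHom δ hδ) = AlgHom.id k _ :=
    env_hom_ext fun x => by
      simp [dualNumberHom_ι, -UniversalEnvelopingAlgebra.ι_apply]
  exact DFunLike.congr_fun h u

/-- The extension of a derivation of a Lie algebra to the enveloping algebra. -/
def envDer : UniversalEnvelopingAlgebra k L →ₗ[k] UniversalEnvelopingAlgebra k L where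
  toFun u := (dualNumberHom δ hδ u).snd
  map_add' _ _ := by simp
  map_smul' _ _ := by simp

lemma envDer_ι (x : L) : envDer δ hδ (ι k x) = ι k (δ x) := by
  change (dualNumberHom δ hδ (ι k x)).snd = _
  simp [dualNumberHom_ι, -UniversalEnvelopingAlgebra.ι_apply]

lemma envDer_mul (u v : UniversalEnvelopingAlgebra k L) :
    envDer δ hδ (u * v) = u * envDer δ hδ v + envDer δ hδ u * v := by
  change (dualNumberHom δ hδ (u * v)).snd = _
  rw [map_mul, TrivSqZeroExt.snd_mul, fst_dualNumberHom, fst_dualNumberHom]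
  rfl

lemma envDer_one : envDer δ hδ 1 = 0 := by
  change (dualNumberHom δ hδ 1).snd = _
  simp

end Derivation

/-! ### The weight filtration of the enveloping algebra. -/

namespace LieFiltration

variable (φ : LieFiltration k L)

/-- The filtration of the enveloping algebra by weight: the `n`-th term is spanned by the products
`x₁ ⋯ xᵣ` with `xᵢ` in the `aᵢ`-th term of the filtration of the Lie algebra and
`a₁ + ⋯ + aᵣ ≥ n`. -/
def wFil (n : ℕ) : Submodule k (UniversalEnvelopingAlgebra k L) :=
  Submodule.span k {u | ∃ l : List (ℕ × L), (∀ x ∈ l, x.2 ∈ φ.F x.1) ∧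
    n ≤ (l.map Prod.fst).sum ∧ (l.map fun x => ι k x.2).prod = u}

variable {φ}

lemma prod_mem_wFil {n : ℕ} (l : List (ℕ × L)) (hl : ∀ x ∈ l, x.2 ∈ φ.F x.1)
    (hn : n ≤ (l.map Prod.fst).sum) : (l.map fun x => ι k x.2).prod ∈ φ.wFil n :=
  Submodule.subset_span ⟨l, hl, hn, rfl⟩

lemma ι_mem_wFil {n : ℕ} {x : L} (hx : x ∈ φ.F n) : ι k x ∈ φ.wFil n := by
  have := prod_mem_wFil (φ := φ) [(n, x)] (n := n) (by simpa using hx) (by simp)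
  rwa [List.map_singleton, List.prod_singleton] at this

lemma one_mem_wFil : 1 ∈ φ.wFil 0 := prod_mem_wFil (φ := φ) [] (by simp) (by simp)

lemma wFil_antitone : Antitone φ.wFil := by
  intro m n h
  refine Submodule.span_mono ?_
  rintro _ ⟨l, hl, hn, rfl⟩
  exact ⟨l, hl, h.trans hn, rfl⟩

lemma wFil_mul_le (m n : ℕ) : φ.wFil m * φ.wFil n ≤ φ.wFil (m + n) := by
  rw [wFil, wFil, Submodule.span_mul_span, Submodule.span_le]
  rintro _ ⟨_, ⟨l, hl, hm, rfl⟩, _, ⟨l', hl', hn, rfl⟩, rfl⟩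
  change (l.map fun x => ι k x.2).prod * (l'.map fun x => ι k x.2).prod ∈ φ.wFil (m + n)
  rw [← List.prod_append, ← List.map_append]
  refine prod_mem_wFil _ (fun x hx => ?_) (by simp; omega)
  rcases List.mem_append.mp hx with hx | hx
  exacts [hl x hx, hl' x hx]

lemma mul_mem_wFil {m n : ℕ} {u v : UniversalEnvelopingAlgebra k L} (hu : u ∈ φ.wFil m)
    (hv : v ∈ φ.wFil n) : u * v ∈ φ.wFil (m + n) :=
  wFil_mul_le m n (Submodule.mul_mem_mul hu hv)

/-- The filtration by weight is the smallest multiplicative filtration compatible with that of the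
Lie algebra. -/
lemma wFil_le {T : ℕ → Submodule k (UniversalEnvelopingAlgebra k L)} (hT : Antitone T)
    (h1 : 1 ∈ T 0) (hmul : ∀ a n x u, x ∈ φ.F a → u ∈ T n → ι k x * u ∈ T (a + n)) (n : ℕ) :
    φ.wFil n ≤ T n := by
  rw [wFil, Submodule.span_le]
  rintro _ ⟨l, hl, hn, rfl⟩
  refine hT hn ?_
  clear hn
  induction l with
  | nil => exact h1
  | cons x l ih =>
    rw [List.map_cons, List.map_cons, List.prod_cons, List.sum_cons]
    exact hmul _ _ _ _ (hl x List.mem_cons_self) (ih fun y hy => hl y (List.mem_cons_of_mem x hy))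

lemma wFil_zero : φ.wFil 0 = ⊤ := by
  let S : Subalgebra k (UniversalEnvelopingAlgebra k L) :=
    (φ.wFil 0).toSubalgebra one_mem_wFil fun _ _ hx hy => by
      simpa using mul_mem_wFil hx hy
  have h : Algebra.adjoin k (Set.range (ι k (L := L))) ≤ S := by
    refine Algebra.adjoin_le ?_
    rintro _ ⟨x, rfl⟩
    exact ι_mem_wFil (by rw [φ.F_zero]; trivial)
  rw [adjoin_ι] at h
  refine top_le_iff.mp fun u _ => ?_
  exact h (Algebra.mem_top (x := u))

/-- An element of `U(L)` is a constant plus a combination of products `v * ι x`. The counit kills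
the products, so on the augmentation ideal the constant is zero, and each product has weight at
least `1`. -/
lemma counit_ker_le_wFil :
    LinearMap.ker (Coalgebra.counit (R := k) (A := UniversalEnvelopingAlgebra k L)) ≤
      φ.wFil 1 := by
  intro u hu
  obtain ⟨a, ha, b, hb, rfl⟩ := Submodule.mem_sup.mp (top_eq_one_sup (Submodule.mem_top (x := u)))
  have hle : ⊤ * LinearMap.range (ι k : L →ₗ⁅k⁆ _).toLinearMap ≤ φ.wFil 1 := by
    rw [Submodule.mul_le]
    rintro v - _ ⟨x, rfl⟩
    have := mul_mem_wFil (φ := φ) (m := 0) (n := 1) (u := v) (by rw [wFil_zero]; trivial)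
      (ι_mem_wFil (x := x) (by rw [φ.one_eq_top]; trivial))
    rwa [zero_add] at this
  have hker : ⊤ * LinearMap.range (ι k : L →ₗ⁅k⁆ _).toLinearMap ≤
      LinearMap.ker (Coalgebra.counit (R := k) (A := UniversalEnvelopingAlgebra k L)) := by
    refine le_trans ?_ top_mul_counit_ker
    gcongr
    rintro _ ⟨x, rfl⟩
    exact counit_ι x
  obtain ⟨c, rfl⟩ := Submodule.mem_one.mp ha
  have hc : c = 0 := by
    have h0 := hker hb
    rw [LinearMap.mem_ker] at hu h0
    rwa [map_add, h0, add_zero, Bialgebra.counit_algebraMap] at hu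
  rw [hc, map_zero, zero_add]
  exact hle hb

/-- A factor from the augmentation ideal raises the weight by at least one, and the ideal generated
by the `(n+1)`-st term has weight `n + 1`. Thus separation statements need only be proved for the
weight filtration, which is multiplicative and has explicit spanning elements. -/
lemma envFil_le_wFil (n : ℕ) : φ.envFil n ≤ φ.wFil n := by
  induction n with
  | zero => rw [wFil_zero]; exact le_top
  | succ n ih =>
    rw [envFil]
    refine sup_le ((mul_le_mul' ih counit_ker_le_wFil).trans (wFil_mul_le n 1)) ?_
    have h : ⊤ * (φ.F (n + 1)).map (ι k : L →ₗ⁅k⁆ _).toLinearMap * ⊤ ≤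
        φ.wFil 0 * φ.wFil (n + 1) * φ.wFil 0 := by
      rw [wFil_zero]
      gcongr
      rintro _ ⟨x, hx, rfl⟩
      exact ι_mem_wFil hx
    refine h.trans ((mul_le_mul' (wFil_mul_le _ _) le_rfl).trans ((wFil_mul_le _ _).trans ?_))
    exact wFil_antitone (by omega)

lemma envDer_mem_wFil (δ : L →ₗ[k] L) (hδ : ∀ x y, δ ⁅x, y⁆ = ⁅δ x, y⁆ + ⁅x, δ y⁆) (m : ℕ)
    (hm : ∀ i, ∀ x ∈ φ.F i, δ x ∈ φ.F (m + i)) (n : ℕ) :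
    ∀ u ∈ φ.wFil n, envDer δ hδ u ∈ φ.wFil (m + n) := by
  -- The Leibniz rule for `ι x * u` involves `u` itself next to its derivative, so the induction
  -- carries both memberships at once.
  have h := wFil_le (φ := φ) (T := fun n => φ.wFil n ⊓ (φ.wFil (m + n)).comap (envDer δ hδ))
    (fun a b hab => inf_le_inf (wFil_antitone hab)
      (Submodule.comap_mono (wFil_antitone (by omega))))
    ⟨one_mem_wFil, by
      change envDer δ hδ 1 ∈ φ.wFil (m + 0)
      rw [envDer_one]
      exact Submodule.zero_mem _⟩ (by
      rintro a n x u hx ⟨hu, hu'⟩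
      refine ⟨mul_mem_wFil (ι_mem_wFil hx) hu, ?_⟩
      change envDer δ hδ (ι k x * u) ∈ φ.wFil (m + (a + n))
      rw [envDer_mul, envDer_ι]
      refine Submodule.add_mem _ ?_ ?_
      · have := mul_mem_wFil (ι_mem_wFil hx) hu'
        rwa [show a + (m + n) = m + (a + n) by omega] at this
      · have := mul_mem_wFil (ι_mem_wFil (hm a x hx)) hu
        rwa [add_assoc] at this) n
  exact fun u hu => (h hu).2

end LieFiltration

end WeightFiltration

/-! ### A finite-dimensional Lie algebra with separated filtration embeds into a quotient of its
enveloping algebra. -/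

section Separation

variable {k : Type*} [Field k] {L : Type*} [LieRing L] [LieAlgebra k L]

namespace LieFiltration

variable {φ : LieFiltration k L}

/-- The filtration of a Lie subalgebra by the traces of the terms of the filtration. -/
def restrict (φ : LieFiltration k L) (H : LieSubalgebra k L) : LieFiltration k H where
  F n := (φ.F n).comap H.toSubmodule.subtype
  antitone' _ _ h := Submodule.comap_mono (φ.antitone' h)
  one_eq_top := by rw [φ.one_eq_top, Submodule.comap_top]
  lie_mem' i j x hx y hy := φ.lie_mem' i j x hx y hy

section HyperplaneAction

variable (H : LieSubalgebra k L) (lam : L →ₗ[k] k) (hH : ∀ x, x ∈ H ↔ lam x = 0)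
  (hlam : ∀ x y : L, lam ⁅x, y⁆ = 0) (e : L) (he : lam e = 1)

/-- The derivation `y ↦ ⁅e, y⁆` of a hyperplane that contains all brackets. -/
def hyperplaneDer : H →ₗ[k] H where
  toFun y := ⟨⁅e, (y : L)⁆, (hH _).mpr (hlam _ _)⟩
  map_add' _ _ := Subtype.ext (by simp)
  map_smul' _ _ := Subtype.ext (by simp)

lemma hyperplaneDer_lie (x y : H) : hyperplaneDer H lam hH hlam e ⁅x, y⁆ =
    ⁅hyperplaneDer H lam hH hlam e x, y⁆ + ⁅x, hyperplaneDer H lam hH hlam e y⁆ := by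
  apply Subtype.ext
  change ⁅e, ⁅(x : L), (y : L)⁆⁆ = ⁅⁅e, (x : L)⁆, (y : L)⁆ + ⁅(x : L), ⁅e, (y : L)⁆⁆
  rw [leibniz_lie]

/-- The projection onto a hyperplane `H` along a vector `e`. -/
def hyperplaneProj : L →ₗ[k] H where
  toFun x := ⟨x - lam x • e, by
    rw [hH, map_sub, map_smul, he, smul_eq_mul, mul_one, sub_self]⟩
  map_add' _ _ := Subtype.ext (by simp [add_smul]; abel)
  map_smul' _ _ := Subtype.ext (by simp [smul_sub, mul_smul])

/-- A Lie algebra `L = H ⊕ k e`, with `H` a hyperplane containing all brackets, acts on the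
enveloping algebra of `H`: elements of `H` act by left multiplication, and `e` by the derivation
that extends `y ↦ ⁅e, y⁆`. -/
def hyperplaneAction : L →ₗ⁅k⁆ Module.End k (UniversalEnvelopingAlgebra k H) where
  toFun x := LinearMap.mulLeft k (ι k (hyperplaneProj H lam hH e he x)) +
    lam x • envDer _ (hyperplaneDer_lie H lam hH hlam e)
  map_add' x y := by
    ext u
    simp [-UniversalEnvelopingAlgebra.ι_apply, add_mul, add_smul]
    abel
  map_smul' c x := by
    ext u
    simp [-UniversalEnvelopingAlgebra.ι_apply, mul_smul]
  map_lie' := by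
    intro x y
    set p := hyperplaneProj H lam hH e he
    set δ := hyperplaneDer H lam hH hlam e with hδ
    -- The projection `p` along `e` is not a Lie morphism. The two correction terms are exactly
    -- those produced by the commutators of left multiplications with the derivation extending `ad
    -- e`.
    have hb : p ⁅x, y⁆ = ⁅p x, p y⁆ + lam x • δ (p y) - lam y • δ (p x) := by
      apply Subtype.ext
      change ⁅x, y⁆ - lam ⁅x, y⁆ • e = ⁅x - lam x • e, y - lam y • e⁆ +
        lam x • ⁅e, y - lam y • e⁆ - lam y • ⁅e, x - lam x • e⁆
      rw [hlam, zero_smul, sub_zero]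
      simp only [lie_sub, sub_lie, lie_smul, smul_lie, lie_self, smul_zero, sub_zero]
      rw [← lie_skew e x]
      simp only [smul_neg]
      abel
    ext u
    simp only [hlam, zero_smul, add_zero, LieRing.of_associative_ring_bracket,
      LinearMap.sub_apply, Module.End.mul_apply, LinearMap.add_apply, LinearMap.smul_apply,
      LinearMap.mulLeft_apply, hb, map_sub, map_add, map_smul, LieHom.map_lie, envDer_mul, envDer_ι,
      mul_add, add_mul, sub_mul, smul_mul_assoc, mul_smul_comm, smul_add, mul_assoc,
      smul_smul]
    -- The terms in which the derivation acts twice cancel because the scalars commute.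
    rw [mul_comm (lam y) (lam x)]
    abel

/-- The action of the enveloping algebra of `L = H ⊕ k e` on that of `H`. -/
def hyperplaneEnvAction : UniversalEnvelopingAlgebra k L →ₐ[k]
    Module.End k (UniversalEnvelopingAlgebra k H) :=
  UniversalEnvelopingAlgebra.lift k (hyperplaneAction H lam hH hlam e he)

lemma hyperplaneEnvAction_ι (x : L) (u : UniversalEnvelopingAlgebra k H) :
    hyperplaneEnvAction H lam hH hlam e he (ι k x) u =
      ι k (hyperplaneProj H lam hH e he x) * u +
        lam x • envDer _ (hyperplaneDer_lie H lam hH hlam e) u := by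
  rw [hyperplaneEnvAction, UniversalEnvelopingAlgebra.lift_ι_apply]
  rfl

/-- An element `x` of the `a`-th term must raise weights by at least `a`. If `a ≤ m`, then the
`a`-th term is everything, so the projection of `x` to `H` has weight `a`, and `ad e` raises weights
by `m ≥ a` because `e` lies in the `m`-th term. If `a > m`, then `lam x = 0` and `x` acts by left
multiplication alone. -/
lemma hyperplaneEnvAction_mem (m : ℕ) (hm : φ.F m = ⊤) (hm' : ∀ x ∈ φ.F (m + 1), lam x = 0)
    (n : ℕ) : ∀ u ∈ φ.wFil n, ∀ b, ∀ v ∈ (φ.restrict H).wFil b,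
      hyperplaneEnvAction H lam hH hlam e he u v ∈ (φ.restrict H).wFil (n + b) := by
  let T : ℕ → Submodule k (UniversalEnvelopingAlgebra k L) := fun n =>
    { carrier := {u | ∀ b, ∀ v ∈ (φ.restrict H).wFil b,
        hyperplaneEnvAction H lam hH hlam e he u v ∈ (φ.restrict H).wFil (n + b)}
      zero_mem' := fun b v _ => by
        rw [map_zero]
        exact Submodule.zero_mem _
      add_mem' := fun {u u'} hu hu' b v hv => by
        rw [map_add]
        exact Submodule.add_mem _ (hu b v hv) (hu' b v hv)
      smul_mem' := fun c u hu b v hv => by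
        rw [map_smul]
        exact Submodule.smul_mem _ c (hu b v hv) }
  refine fun u hu => wFil_le (φ := φ) (T := T) ?_ ?_ ?_ n hu
  · exact fun a b hab u hu c v hv => wFil_antitone (by omega) (hu c v hv)
  · intro b v hv
    rw [map_one, zero_add]
    exact hv
  · intro a n x u hx hu b v hv
    rw [map_mul, Module.End.mul_apply, hyperplaneEnvAction_ι, add_assoc]
    have hw := hu b v hv
    have hxm : x ∈ φ.F m := by rw [hm]; trivial
    refine Submodule.add_mem _ (mul_mem_wFil (ι_mem_wFil ?_) hw) ?_
    · change x - lam x • e ∈ φ.F a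
      rcases le_or_gt a m with ham | ham
      · have : φ.F a = ⊤ := top_le_iff.mp (hm ▸ φ.antitone' ham)
        rw [this]
        trivial
      · rwa [hm' x (φ.antitone' ham hx), zero_smul, sub_zero]
    · rcases le_or_gt a m with ham | ham
      · refine Submodule.smul_mem _ _ (wFil_antitone (show a + (n + b) ≤ m + (n + b) by omega)
          (envDer_mem_wFil _ _ m ?_ _ _ hw))
        intro i y hy
        exact φ.lie_mem' m i e (by rw [hm]; trivial) y hy
      · rw [hm' x (φ.antitone' ham hx), zero_smul]
        exact Submodule.zero_mem _

end HyperplaneAction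

/-- A linear form on a Lie algebra vanishing on brackets, as a Lie morphism to the dual numbers. -/
def dualNumberForm (lam : L →ₗ[k] k) (hlam : ∀ x y : L, lam ⁅x, y⁆ = 0) : L →ₗ⁅k⁆ DualNumber k where
  toFun x := TrivSqZeroExt.inr (lam x)
  map_add' x y := by rw [map_add, TrivSqZeroExt.inr_add]
  map_smul' c x := by rw [map_smul, TrivSqZeroExt.inr_smul, RingHom.id_apply]
  map_lie' := by
    intro x y
    change TrivSqZeroExt.inr (lam ⁅x, y⁆) = _
    rw [hlam, LieRing.of_associative_ring_bracket, mul_comm, sub_self, TrivSqZeroExt.inr_zero]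

/-- Extend the form to an algebra morphism `U(L) → k[ε]`, `x ↦ lam x ε`. Products of two or more Lie
elements die since `ε² = 0`, and a single factor of weight at least `m + 1` is killed by `lam`. -/
lemma form_eq_zero_of_ι_mem_wFil (lam : L →ₗ[k] k) (hlam : ∀ x y : L, lam ⁅x, y⁆ = 0) (m : ℕ)
    (hm' : ∀ x ∈ φ.F (m + 1), lam x = 0) (x : L) (hx : ι k x ∈ φ.wFil (m + 1)) : lam x = 0 := by
  let Λ := UniversalEnvelopingAlgebra.lift k (dualNumberForm lam hlam)
  have hΛ : ∀ y, Λ (ι k y) = TrivSqZeroExt.inr (lam y) := fun y => by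
    rw [UniversalEnvelopingAlgebra.lift_ι_apply]
    rfl
  -- The condition on the first component, that it vanishes in positive weight, is what makes
  -- products of several Lie elements die.
  let T : ℕ → Submodule k (UniversalEnvelopingAlgebra k L) := fun n =>
    { carrier := {u | (1 ≤ n → (Λ u).fst = 0) ∧ (m + 1 ≤ n → (Λ u).snd = 0)}
      zero_mem' := by simp
      add_mem' := fun {u v} hu hv =>
        ⟨fun h => by rw [map_add, TrivSqZeroExt.fst_add, hu.1 h, hv.1 h, add_zero],
          fun h => by rw [map_add, TrivSqZeroExt.snd_add, hu.2 h, hv.2 h, add_zero]⟩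
      smul_mem' := fun c u hu =>
        ⟨fun h => by rw [map_smul, TrivSqZeroExt.fst_smul, hu.1 h, smul_zero],
          fun h => by rw [map_smul, TrivSqZeroExt.snd_smul, hu.2 h, smul_zero]⟩ }
  have key := wFil_le (φ := φ) (T := T)
    (fun a b hab u hu => ⟨fun h => hu.1 (h.trans hab), fun h => hu.2 (h.trans hab)⟩)
    ⟨by simp, by simp⟩ (by
      rintro a n y u hy ⟨hu1, -⟩
      refine ⟨fun _ => ?_, fun h => ?_⟩
      · rw [map_mul, TrivSqZeroExt.fst_mul, hΛ, TrivSqZeroExt.fst_inr, zero_mul]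
      · rw [map_mul, TrivSqZeroExt.snd_mul, hΛ, TrivSqZeroExt.fst_inr, TrivSqZeroExt.snd_inr,
          zero_smul, zero_add]
        rcases Nat.eq_zero_or_pos n with hn | hn
        · rw [hm' y (φ.antitone' (by omega) hy), smul_zero]
        · rw [hu1 hn, MulOpposite.op_zero, zero_smul]) (m + 1) hx
  have := key.2 le_rfl
  rwa [hΛ, TrivSqZeroExt.snd_inr] at this

/-- Split off one dimension at a time: a linear form vanishing on the first proper term of the
filtration puts `x` in its kernel `H`, and letting `x` act on `1` in `U(H)` transports the
hypothesis to `H`. No Poincaré–Birkhoff–Witt basis is needed. -/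
lemma eq_zero_of_ι_mem_wFil_aux (d : ℕ) : ∀ {L : Type*} [LieRing L] [LieAlgebra k L]
    [FiniteDimensional k L] (φ : LieFiltration k L) (_ : Module.finrank k L ≤ d) (M : ℕ)
    (_ : φ.F M = ⊥) (x : L) (_ : ∀ n, ι k x ∈ φ.wFil n), x = 0 := by
  induction d with
  | zero =>
    intro L _ _ _ φ hd M hM x hx
    have := Module.finrank_zero_iff.mp (Nat.le_zero.mp hd)
    exact Subsingleton.elim _ _
  | succ d ih =>
    intro L _ _ _ φ hd M hM x hx
    by_cases htriv : (⊤ : Submodule k L) = ⊥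
    · exact (Submodule.mem_bot k).mp (htriv ▸ Submodule.mem_top)
    -- The last index at which the filtration is still everything. It exists because the filtration
    -- reaches zero in a nonzero Lie algebra.
    obtain ⟨m, hm, hlt⟩ : ∃ m, φ.F m = ⊤ ∧ φ.F (m + 1) ≠ ⊤ := by
      by_contra! hcon
      have : ∀ n, φ.F n = ⊤ := fun n => by
        induction n with
        | zero => exact φ.F_zero
        | succ n ihn => exact hcon n ihn
      exact htriv ((this M).symm.trans hM)
    obtain ⟨f, hf, hker⟩ := Submodule.exists_le_ker_of_lt_top _ (lt_top_iff_ne_top.mpr hlt)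
    obtain ⟨e, he⟩ : ∃ e, f e = 1 := by
      obtain ⟨y, hy⟩ : ∃ y, f y ≠ 0 := by
        by_contra! h
        exact hf (LinearMap.ext h)
      exact ⟨(f y)⁻¹ • y, by rw [map_smul, smul_eq_mul, inv_mul_cancel₀ hy]⟩
    have hm1 : 1 ≤ m := by
      by_contra h
      obtain rfl : m = 0 := by omega
      exact hlt φ.one_eq_top
    -- All brackets lie in the `2m`-th term, which is contained in the `(m+1)`-st since `m ≥ 1`. So
    -- the hyperplane `ker f` is a subalgebra stable under `ad e`.
    have hlam : ∀ x y : L, f ⁅x, y⁆ = 0 := fun x y => hker (φ.antitone' (by omega : m + 1 ≤ m + m)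
      (φ.lie_mem' m m x (by rw [hm]; trivial) y (by rw [hm]; trivial)))
    let H : LieSubalgebra k L := { LinearMap.ker f with lie_mem' := fun _ _ => hlam _ _ }
    have hH : ∀ x, x ∈ H ↔ f x = 0 := fun x => LinearMap.mem_ker
    have hfx : f x = 0 := form_eq_zero_of_ι_mem_wFil f hlam m hker x (hx _)
    have hHd : Module.finrank k H ≤ d := by
      have : Module.finrank k (LinearMap.ker f) < Module.finrank k L :=
        Submodule.finrank_lt fun h => hf (LinearMap.ker_eq_top.mp h)
      change Module.finrank k (LinearMap.ker f) ≤ d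
      omega
    have hz := ih (φ.restrict H) hHd M (by
        change (φ.F M).comap _ = ⊥
        rw [hM]
        exact Submodule.ker_subtype _) ⟨x, hfx⟩ fun n => by
      -- Since `f x = 0`, the element `x` sends `1` to its own image in `U(H)`, which therefore has
      -- weight at least `n`.
      have := hyperplaneEnvAction_mem H f hH hlam e he m hm hker n _ (hx n) 0 1 one_mem_wFil
      rw [hyperplaneEnvAction_ι, hfx, zero_smul, mul_one, add_zero, add_zero] at this
      have hp : hyperplaneProj H f hH e he x = ⟨x, hfx⟩ := Subtype.ext (by
        change x - f x • e = x
        rw [hfx, zero_smul, sub_zero])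
      rwa [hp] at this
    exact congrArg Subtype.val hz

/-- A finite-dimensional Lie algebra with a separated filtration embeds into its enveloping
algebra, modulo some term of the filtration of the latter. -/
lemma exists_ι_notMem_envFil [FiniteDimensional k L] (M : ℕ) (hM : φ.F M = ⊥) :
    ∃ n, ∀ x : L, ι k x ∈ φ.envFil n → x = 0 := by
  -- The preimages of the `F^n` form a decreasing chain of subspaces of a finite-dimensional space,
  -- an increasing one in the order dual, so it stabilises. The stable value lies in every term of
  -- the weight filtration.
  let P : ℕ →o (Submodule k L)ᵒᵈ :=
    ⟨fun n => (φ.envFil n).comap (ι k : L →ₗ⁅k⁆ _).toLinearMap,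
      fun _ _ h => Submodule.comap_mono (φ.envFil_antitone h)⟩
  obtain ⟨n, hn⟩ := WellFoundedGT.monotone_chain_condition P
  refine ⟨n, fun x hx => eq_zero_of_ι_mem_wFil_aux _ φ le_rfl M hM x fun j => ?_⟩
  have hx' : x ∈ (φ.envFil (max n j)).comap (ι k : L →ₗ⁅k⁆ _).toLinearMap := by
    have : P n = P (max n j) := hn _ (le_max_left n j)
    exact (show (φ.envFil n).comap _ = (φ.envFil (max n j)).comap _ from this) ▸ hx
  exact wFil_antitone (le_max_right n j) (envFil_le_wFil _ hx')

/-- Since `L_p` embeds into some `U(L_p) / F^(n+1)`, a functional on `L_p` extends to that quotient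
through a linear retraction, and pulls back to `U(L)`. -/
lemma toK_surjective (φ : LieFiltration k L) [∀ p, FiniteDimensional k (φ.Quo p)] :
    Function.Surjective φ.toK := by
  rintro ⟨_, p, g, rfl⟩
  have hM : (φ.quo p).F (p + 1) = ⊥ := by
    rw [eq_bot_iff]
    rintro _ ⟨x, hx, rfl⟩
    exact (Submodule.Quotient.mk_eq_zero _).mpr hx
  obtain ⟨n, hn⟩ := exists_ι_notMem_envFil (p + 1) hM
  obtain ⟨r, hr⟩ := LinearMap.exists_leftInverse_of_injective
    (((φ.quo p).envFil (n + 1)).mkQ ∘ₗ (ι k : φ.Quo p →ₗ⁅k⁆ _).toLinearMap) (by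
      rw [LinearMap.ker_eq_bot']
      exact fun x hx => hn x ((φ.quo p).envFil_succ_le n
        ((Submodule.Quotient.mk_eq_zero _).mp hx)))
  refine ⟨⟨WithConv.toConv ((g ∘ₗ r ∘ₗ ((φ.quo p).envFil (n + 1)).mkQ) ∘ₗ
    (envMap (φ.proj p)).toLinearMap), p, n, mem_UcStage.mpr ⟨_, fun u hu => ?_, rfl⟩⟩, ?_⟩
  · rw [LinearMap.comp_apply, LinearMap.comp_apply, Submodule.mkQ_apply,
      (Submodule.Quotient.mk_eq_zero _).mpr hu, map_zero, map_zero]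
  · apply Subtype.ext
    ext x
    change g (r (((φ.quo p).envFil (n + 1)).mkQ (envMap (φ.proj p) (ι k x)))) = g (φ.proj p x)
    rw [envMap_ι]
    exact congrArg g (LinearMap.congr_fun hr (φ.proj p x))

end LieFiltration

end Separation

/-! ### Powers of Lie elements span the enveloping algebra. -/

lemma mem_of_forall_sum_pow_smul_mem {k V : Type*} [Field k] [CharZero k] [AddCommGroup V]
    [Module k V] (P : Submodule k V) (n : ℕ) (c : ℕ → V)
    (h : ∀ t : k, ∑ i ∈ Finset.range n, t ^ i • c i ∈ P) (i : ℕ) (hi : i < n) : c i ∈ P := by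
  -- A functional that vanishes on `P` but not on `c i` turns the hypothesis into a nonzero scalar
  -- polynomial vanishing at every point of an infinite field.
  by_contra hc
  obtain ⟨f, hf, hP⟩ := Submodule.exists_le_ker_of_notMem hc
  have hq : ∑ j ∈ Finset.range n, Polynomial.monomial j (f (c j)) = 0 := by
    refine Polynomial.funext fun t => ?_
    have := LinearMap.mem_ker.mp (hP (h t))
    rw [map_sum] at this
    rw [Polynomial.eval_finsetSum, Polynomial.eval_zero, ← this]
    refine Finset.sum_congr rfl fun j _ => ?_
    rw [Polynomial.eval_monomial, map_smul, smul_eq_mul, mul_comm]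
  have := congrArg (fun q => Polynomial.coeff q i) hq
  simp only [Polynomial.finsetSum_coeff, Polynomial.coeff_monomial, Polynomial.coeff_zero] at this
  rw [Finset.sum_ite_eq' (Finset.range n) i, if_pos (Finset.mem_range.mpr hi)] at this
  exact hf this

section Powers

variable {k : Type*} [Field k] {L : Type*} [LieRing L] [LieAlgebra k L]

variable (k L) in
/-- The span of the powers of elements of the Lie algebra in the enveloping algebra. -/
def powerSpan : Submodule k (UniversalEnvelopingAlgebra k L) :=
  Submodule.span k {u | ∃ (x : L) (n : ℕ), ι k x ^ n = u}

lemma pow_mem_powerSpan (x : L) (n : ℕ) : ι k x ^ n ∈ powerSpan k L :=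
  Submodule.subset_span ⟨x, n, rfl⟩

variable (k) in
/-- The span of the products `y * x ^ r` with `r < n`, for a given `x`. -/
def mulPowSpan (x : L) (n : ℕ) : Submodule k (UniversalEnvelopingAlgebra k L) :=
  Submodule.span k {u | ∃ (y : L) (r : ℕ), r < n ∧ ι k y * ι k x ^ r = u}

lemma mul_pow_mem_mulPowSpan (x y : L) {r n : ℕ} (h : r < n) :
    ι k y * ι k x ^ r ∈ mulPowSpan k x n :=
  Submodule.subset_span ⟨y, r, h, rfl⟩

lemma mulPowSpan_mul (x : L) (n : ℕ) (u : UniversalEnvelopingAlgebra k L)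
    (hu : u ∈ mulPowSpan k x n) : u * ι k x ∈ mulPowSpan k x (n + 1) := by
  have h : mulPowSpan k x n ≤ (mulPowSpan k x (n + 1)).comap (LinearMap.mulRight k (ι k x)) := by
    refine Submodule.span_le.mpr ?_
    rintro _ ⟨y, r, hr, rfl⟩
    change ι k y * ι k x ^ r * ι k x ∈ mulPowSpan k x (n + 1)
    rw [mul_assoc, ← pow_succ]
    exact mul_pow_mem_mulPowSpan x y (by omega)
  exact h hu

lemma ι_mul_mulPow (x y : L) (r : ℕ) : ι k x * (ι k y * ι k x ^ r) =
    ι k y * ι k x ^ (r + 1) + ι k ⁅x, y⁆ * ι k x ^ r := by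
  rw [LieHom.map_lie, LieRing.of_associative_ring_bracket, pow_succ']
  noncomm_ring

lemma mul_mulPowSpan (x : L) (n : ℕ) (u : UniversalEnvelopingAlgebra k L)
    (hu : u ∈ mulPowSpan k x n) : ι k x * u ∈ mulPowSpan k x (n + 1) := by
  have h : mulPowSpan k x n ≤ (mulPowSpan k x (n + 1)).comap (LinearMap.mulLeft k (ι k x)) := by
    refine Submodule.span_le.mpr ?_
    rintro _ ⟨y, r, hr, rfl⟩
    change ι k x * (ι k y * ι k x ^ r) ∈ mulPowSpan k x (n + 1)
    rw [ι_mul_mulPow]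
    exact Submodule.add_mem _ (mul_pow_mem_mulPowSpan x _ (by omega))
      (mul_pow_mem_mulPowSpan x _ (by omega))
  exact h hu

/-- Each time a factor `x` passes `y` it is absorbed into a bracket, so the corrections contain
fewer than `n` factors `x` on the right. -/
lemma pow_mul_sub_mem (x y : L) (n : ℕ) :
    ι k x ^ n * ι k y - ι k y * ι k x ^ n ∈ mulPowSpan k x n := by
  induction n with
  | zero => simp [-UniversalEnvelopingAlgebra.ι_apply]
  | succ n ih =>
    have h : ι k x ^ (n + 1) * ι k y - ι k y * ι k x ^ (n + 1) =
        ι k x * (ι k x ^ n * ι k y - ι k y * ι k x ^ n) + ι k ⁅x, y⁆ * ι k x ^ n := by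
      rw [mul_sub, ι_mul_mulPow, pow_succ' (ι k x) n]
      noncomm_ring
    rw [h]
    exact Submodule.add_mem _ (mul_mulPowSpan x n _ ih) (mul_pow_mem_mulPowSpan x _ (by omega))

open Polynomial in
/-- The polynomial `(x + t y) ^ n`. -/
def addPow (x y : L) (n : ℕ) : (UniversalEnvelopingAlgebra k L)[X] :=
  (C (ι k x) + X * C (ι k y)) ^ n

lemma coeff_zero_addPow (x y : L) (n : ℕ) : (addPow (k := k) x y n).coeff 0 = ι k x ^ n := by
  induction n with
  | zero => simp [addPow]
  | succ n ih =>
    rw [addPow, pow_succ, mul_add, Polynomial.coeff_add, Polynomial.coeff_mul_C, ← mul_assoc,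
      Polynomial.coeff_mul_C, Polynomial.coeff_mul_X_zero, zero_mul, add_zero, pow_succ]
    exact congrArg (· * ι k x) ih

lemma coeff_one_addPow_succ (x y : L) (n : ℕ) : (addPow (k := k) x y (n + 1)).coeff 1 =
    (addPow (k := k) x y n).coeff 1 * ι k x + ι k x ^ n * ι k y := by
  rw [← coeff_zero_addPow x y n, addPow, pow_succ, mul_add, Polynomial.coeff_add,
    Polynomial.coeff_mul_C, ← mul_assoc, Polynomial.coeff_mul_C, Polynomial.coeff_mul_X]
  rfl

/-- The coefficient is the sum of the `n + 1` words `x ^ i * y * x ^ (n - i)`, and each equals `y *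
x ^ n` up to terms with fewer factors `x`. -/
lemma coeff_one_addPow_sub_mem (x y : L) (n : ℕ) : (addPow (k := k) x y (n + 1)).coeff 1 -
    ((n : k) + 1) • (ι k y * ι k x ^ n) ∈ mulPowSpan k x n := by
  induction n with
  | zero =>
    simp [addPow, -UniversalEnvelopingAlgebra.ι_apply]
  | succ n ih =>
    have h : (addPow (k := k) x y (n + 1 + 1)).coeff 1 -
        (((n + 1 : ℕ) : k) + 1) • (ι k y * ι k x ^ (n + 1)) =
        ((addPow (k := k) x y (n + 1)).coeff 1 - ((n : k) + 1) • (ι k y * ι k x ^ n)) * ι k x +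
          (ι k x ^ (n + 1) * ι k y - ι k y * ι k x ^ (n + 1)) := by
      rw [coeff_one_addPow_succ, sub_mul, smul_mul_assoc, mul_assoc (ι k y), ← pow_succ, add_smul,
        Nat.cast_succ, one_smul]
      abel
    rw [h]
    exact Submodule.add_mem _ (mulPowSpan_mul x n _ ih) (pow_mul_sub_mem x y (n + 1))

/-- At each scalar `t` the polynomial takes the value `(x + t y) ^ n`, which is a power. Enough
scalar values recover the coefficients by linear combination. -/
lemma coeff_one_addPow_mem [CharZero k] (x y : L) (n : ℕ) :
    (addPow (k := k) x y n).coeff 1 ∈ powerSpan k L := by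
  -- The bound `natDegree + 2` exceeds both the degree and the index `1`, also when the polynomial
  -- is constant.
  refine mem_of_forall_sum_pow_smul_mem _ ((addPow (k := k) x y n).natDegree + 2)
    (fun i => (addPow (k := k) x y n).coeff i) (fun t => ?_) 1 (by omega)
  -- Evaluation is multiplicative despite the noncommutative coefficients because the scalar `t` is
  -- central.
  let ev := Polynomial.eval₂RingHom' (RingHom.id (UniversalEnvelopingAlgebra k L))
    (algebraMap k (UniversalEnvelopingAlgebra k L) t) fun a => (Algebra.commutes t a).symm
  have h1 : ev (addPow x y n) = ι k (x + t • y) ^ n := by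
    have h2 : ev (Polynomial.C (ι k x) + Polynomial.X * Polynomial.C (ι k y)) =
        ι k (x + t • y) := by
      rw [map_add, map_mul, map_add, map_smul, Algebra.smul_def]
      simp [ev, Polynomial.eval₂RingHom', -UniversalEnvelopingAlgebra.ι_apply]
    rw [addPow, map_pow, h2]
  have h3 : ev (addPow x y n) = ∑ i ∈ Finset.range ((addPow (k := k) x y n).natDegree + 2),
      t ^ i • (addPow (k := k) x y n).coeff i := by
    change Polynomial.eval₂ _ _ _ = _
    rw [Polynomial.eval₂_eq_sum_range' _ (n := (addPow (k := k) x y n).natDegree + 2) (by omega)]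
    refine Finset.sum_congr rfl fun i _ => ?_
    rw [RingHom.id_apply, ← map_pow, ← Algebra.commutes, ← Algebra.smul_def]
  rw [← h3, h1]
  exact pow_mem_powerSpan _ _

/-- Modulo products with fewer factors `x`, which the induction covers for all left factors, `(n +
1) y * x ^ n` is the linear coefficient of `(x + t y) ^ (n + 1)`. Characteristic zero permits
division by `n + 1`. -/
lemma ι_mul_pow_mem_powerSpan [CharZero k] (x y : L) (n : ℕ) :
    ι k y * ι k x ^ n ∈ powerSpan k L := by
  induction n using Nat.strong_induction_on generalizing y with
  | _ n ih =>
    have hle : mulPowSpan k x n ≤ powerSpan k L := by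
      refine Submodule.span_le.mpr ?_
      rintro _ ⟨z, r, hr, rfl⟩
      exact ih r hr z
    have h := Submodule.sub_mem _ (coeff_one_addPow_mem x y (n + 1))
      (hle (coeff_one_addPow_sub_mem x y n))
    rw [sub_sub_cancel] at h
    exact (Submodule.smul_mem_iff _ (Nat.cast_add_one_ne_zero n)).mp h

/-- In characteristic zero, the enveloping algebra is spanned by the powers of the elements of the
Lie algebra. -/
lemma powerSpan_eq_top [CharZero k] : powerSpan k L = ⊤ := by
  have key : ∀ u ∈ Algebra.adjoin k (Set.range (ι k (L := L))),
      ∀ p ∈ powerSpan k L, u * p ∈ powerSpan k L := by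
    intro u hu
    induction hu using Algebra.adjoin_induction with
    | mem u hu =>
      obtain ⟨y, rfl⟩ := hu
      intro p hp
      have : powerSpan k L ≤ (powerSpan k L).comap (LinearMap.mulLeft k (ι k y)) := by
        conv_lhs => rw [powerSpan]
        refine Submodule.span_le.mpr ?_
        rintro _ ⟨x, n, rfl⟩
        exact ι_mul_pow_mem_powerSpan x y n
      exact this hp
    | algebraMap r =>
      intro p hp
      rw [← Algebra.smul_def]
      exact Submodule.smul_mem _ r hp
    | add a b _ _ ha hb =>
      intro p hp
      rw [add_mul]
      exact Submodule.add_mem _ (ha p hp) (hb p hp)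
    | mul a b _ _ ha hb =>
      intro p hp
      rw [mul_assoc]
      exact ha _ (hb p hp)
  refine top_le_iff.mp fun u _ => ?_
  have := key u (by rw [adjoin_ι]; trivial) 1 (by simpa using pow_mem_powerSpan (k := k) (0 : L) 0)
  rwa [mul_one] at this

lemma comul_pow (x : L) (n : ℕ) : Coalgebra.comul (R := k) (ι k x ^ n) =
    ∑ m ∈ Finset.HasAntidiagonal.antidiagonal n,
      (n.choose m.1 : k) • ((ι k x ^ m.1) ⊗ₜ[k] (ι k x ^ m.2)) := by
  have hc : Commute (ι k x ⊗ₜ[k] (1 : UniversalEnvelopingAlgebra k L)) (1 ⊗ₜ ι k x) := by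
    simp [Commute, SemiconjBy, -UniversalEnvelopingAlgebra.ι_apply]
  rw [Bialgebra.comul_pow, comul_ι, hc.add_pow']
  refine Finset.sum_congr rfl fun m _ => ?_
  rw [Nat.cast_smul_eq_nsmul, Algebra.TensorProduct.tmul_pow, Algebra.TensorProduct.tmul_pow,
    one_pow, one_pow, Algebra.TensorProduct.tmul_mul_tmul, one_mul, mul_one]

lemma counit_pow (x : L) (n : ℕ) :
    Coalgebra.counit (R := k) (ι k x ^ n) = if n = 0 then (1 : k) else 0 := by
  rw [Bialgebra.counit_pow, counit_ι, zero_pow_eq]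

end Powers

/-! ### Convolution as multiplication of exponential generating series. -/

section Series

open PowerSeries WithConv

variable {k : Type*} [Field k] {L : Type*} [LieRing L] [LieAlgebra k L]

/-- An endomorphism of the enveloping algebra acts by the exponential generating series `a` if it
multiplies `x ^ n` by `n!` times the `n`-th coefficient of `a`, for `x` in the Lie algebra. -/
def ActsBy (T : WithConv (UniversalEnvelopingAlgebra k L →ₗ[k] UniversalEnvelopingAlgebra k L))
    (a : k⟦X⟧) : Prop :=
  ∀ (x : L) (n : ℕ), T (ι k x ^ n) = ((n.factorial : k) * coeff n a) • ι k x ^ n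

lemma choose_mul_factorials {n : ℕ} {m : ℕ × ℕ} (hm : m ∈ Finset.HasAntidiagonal.antidiagonal n) :
    (n.choose m.1 : k) * m.1.factorial * m.2.factorial = n.factorial := by
  obtain rfl := Finset.HasAntidiagonal.mem_antidiagonal.mp hm
  have := Nat.choose_mul_factorial_mul_factorial (Nat.le_add_right m.1 m.2)
  rw [Nat.add_sub_cancel_left] at this
  rw [← this, Nat.cast_mul, Nat.cast_mul]

/-- The binomial coefficients in the coproduct of `x ^ n` are those in the product of exponential
generating series. -/
lemma ActsBy.mul {S T : WithConv (UniversalEnvelopingAlgebra k L →ₗ[k]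
    UniversalEnvelopingAlgebra k L)} {a b : k⟦X⟧} (hS : ActsBy S a) (hT : ActsBy T b) :
    ActsBy (S * T) (a * b) := by
  intro x n
  rw [LinearMap.convMul_apply, comul_pow, coeff_mul, Finset.mul_sum, Finset.sum_smul]
  simp only [map_sum, map_smul, TensorProduct.map_tmul, LinearMap.mul'_apply]
  refine Finset.sum_congr rfl fun m hm => ?_
  change (n.choose m.1 : k) • (S (ι k x ^ m.1) * T (ι k x ^ m.2)) = _
  rw [hS, hT, smul_mul_smul_comm, ← pow_add, Finset.HasAntidiagonal.mem_antidiagonal.mp hm,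
    smul_smul, ← choose_mul_factorials (k := k) hm]
  congr 1
  ring

lemma ActsBy.sub {S T : WithConv (UniversalEnvelopingAlgebra k L →ₗ[k]
    UniversalEnvelopingAlgebra k L)} {a b : k⟦X⟧} (hS : ActsBy S a) (hT : ActsBy T b) :
    ActsBy (S - T) (a - b) := by
  intro x n
  change S (ι k x ^ n) - T (ι k x ^ n) = _
  rw [hS, hT, map_sub, mul_sub, sub_smul]

lemma ActsBy.one : ActsBy (1 : WithConv (UniversalEnvelopingAlgebra k L →ₗ[k]
    UniversalEnvelopingAlgebra k L)) 1 := by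
  intro x n
  rw [LinearMap.convOne_apply, counit_pow, coeff_one]
  split_ifs with h
  · simp [h]
  · simp

lemma ActsBy.pow {S : WithConv (UniversalEnvelopingAlgebra k L →ₗ[k]
    UniversalEnvelopingAlgebra k L)} {a : k⟦X⟧} (hS : ActsBy S a) (n : ℕ) :
    ActsBy (S ^ n) (a ^ n) := by
  induction n with
  | zero => rw [pow_zero, pow_zero]; exact ActsBy.one
  | succ n ih => rw [pow_succ, pow_succ]; exact ih.mul hS

lemma ActsBy.id [CharZero k] : ActsBy (toConv LinearMap.id : WithConv (UniversalEnvelopingAlgebra k L →ₗ[k]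
    UniversalEnvelopingAlgebra k L)) (exp k) := by
  intro x n
  have : (n.factorial : k) ≠ 0 := Nat.cast_ne_zero.mpr n.factorial_ne_zero
  rw [coeff_exp, map_div₀, map_one, map_natCast, mul_one_div_cancel this, one_smul]
  rfl

lemma coeff_exp_sub_one_pow_of_lt [CharZero k] {n m : ℕ} (h : n < m) : coeff n ((exp k - 1) ^ m) = 0 := by
  have h1 : (X : k⟦X⟧) ∣ exp k - 1 := by
    rw [X_dvd_iff, map_sub, constantCoeff_exp, map_one, sub_self]
  exact X_pow_dvd_iff.mp (pow_dvd_pow_of_dvd h1 m) n h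

/-- The logarithm of the exponential series is the variable. -/
lemma coeff_log_exp [CharZero k] (M n : ℕ) (hn : n ≤ M) : ∑ m ∈ Finset.range M,
    ((-1) ^ m / (m + 1) : k) * coeff n ((exp k - 1) ^ (m + 1)) = if n = 1 then 1 else 0 := by
  rcases n with _ | n
  · rw [if_neg (by omega)]
    refine Finset.sum_eq_zero fun m _ => ?_
    rw [coeff_exp_sub_one_pow_of_lt (by omega), mul_zero]
  have hn' : (n : k) + 1 ≠ 0 := Nat.cast_add_one_ne_zero n
  -- Differentiating `(exp - 1) ^ (m + 1)`, with `exp = (exp - 1) + 1`, gives `m + 1` times the sum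
  -- of two consecutive powers of `exp - 1`. The alternating signs then make the sum over `m`
  -- telescope.
  have h1 : ∀ m : ℕ, ((-1) ^ m / (m + 1) : k) * coeff (n + 1) ((exp k - 1) ^ (m + 1)) * (n + 1) =
      (-1) ^ m * coeff n ((exp k - 1) ^ m) - (-1) ^ (m + 1) * coeff n ((exp k - 1) ^ (m + 1)) := by
    intro m
    have hm : (m : k) + 1 ≠ 0 := Nat.cast_add_one_ne_zero m
    have hd : derivative k ((exp k - 1) ^ (m + 1)) =
        C ((m : k) + 1) * ((exp k - 1) ^ m + (exp k - 1) ^ (m + 1)) := by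
      rw [derivative_pow, map_sub, derivative_exp, derivative_one, sub_zero, Nat.add_sub_cancel,
        map_add, map_natCast, map_one, Nat.cast_succ]
      ring
    have := congrArg (coeff n) hd
    rw [coeff_derivative, coeff_C_mul, map_add] at this
    rw [mul_assoc, this]
    field_simp
    ring
  refine mul_right_cancel₀ hn' ?_
  -- Only the power `0` survives: the term at the upper end is divisible by `X ^ M`, and `n < M`.
  rw [Finset.sum_mul, Finset.sum_congr rfl fun m _ => h1 m, Finset.sum_range_sub',
    coeff_exp_sub_one_pow_of_lt (show n < M by omega), mul_zero, sub_zero, pow_zero, pow_zero, one_mul,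
    coeff_one]
  rcases n with _ | n <;> simp

end Series

/-! ### Elements of `U^c(K)` as polynomial functions, and the isomorphism. -/

section PolynomialFunctions

open PowerSeries WithConv

variable {k : Type*} [Field k] {L : Type*} [LieRing L] [LieAlgebra k L]

namespace LieFiltration

variable (φ : LieFiltration k L)

instance : Module.Free k φ.K := Module.Free.of_divisionRing k φ.K

/-- Restriction of functionals to the formal one-parameter group of `x`, as a linear map:
`f ↦ ∑ f (x ^ n) / n! t ^ n`. -/
def expSeriesLinear (x : L) : φ.Uc →ₗ[k] k⟦X⟧ where
  toFun f := PowerSeries.mk fun n => (n.factorial : k)⁻¹ * Uc.eval f (ι k x ^ n)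
  map_add' f g := by
    ext n
    simp only [coeff_mk, map_add, LinearMap.add_apply, mul_add]
  map_smul' c f := by
    ext n
    simp only [coeff_mk, map_smul, LinearMap.smul_apply, smul_eq_mul, RingHom.id_apply]
    ring

variable {φ}

lemma coeff_expSeriesLinear (x : L) (f : φ.Uc) (n : ℕ) :
    coeff n (expSeriesLinear φ x f) = (n.factorial : k)⁻¹ * Uc.eval f (ι k x ^ n) :=
  coeff_mk n fun n => (n.factorial : k)⁻¹ * Uc.eval f (ι k x ^ n)

lemma toK_apply (f : φ.Uc) (x : L) : (φ.toK f : Module.Dual k L) x = Uc.eval f (ι k x) := rfl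

/-- Finitely many linearly independent linear forms take arbitrary values. -/
lemma exists_forall_eq_of_linearIndependent {V σ : Type*} [AddCommGroup V] [Module k V] [Fintype σ]
    {β : σ → Module.Dual k V} (hβ : LinearIndependent k β) (c : σ → k) :
    ∃ x, ∀ i, β i x = c i := by
  classical
  -- If the joint values filled only a proper subspace, a functional vanishing on it would be a
  -- linear relation among the forms.
  suffices h : LinearMap.range (LinearMap.pi β) = ⊤ by
    obtain ⟨x, hx⟩ := LinearMap.range_eq_top.mp h c
    exact ⟨x, fun i => congrFun hx i⟩
  by_contra h
  obtain ⟨f, hf, hker⟩ := Submodule.exists_le_ker_of_lt_top _ (lt_top_iff_ne_top.mpr h)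
  refine hf (LinearMap.pi_ext' fun i => LinearMap.ext_ring ?_)
  have hsum : ∑ i, f (Pi.single i 1) • β i = 0 := by
    ext x
    have := LinearMap.mem_ker.mp (hker (LinearMap.mem_range_self (LinearMap.pi β) x))
    rw [LinearMap.pi_apply_eq_sum_univ f] at this
    rw [LinearMap.sum_apply, LinearMap.zero_apply, ← this]
    exact Finset.sum_congr rfl fun i _ => by
      rw [LinearMap.smul_apply, smul_eq_mul, mul_comm, LinearMap.pi_apply, smul_eq_mul]
      congr 2
      ext j
      simp [Pi.single_apply, eq_comm]
  exact Fintype.linearIndependent_iff.mp hβ _ hsum i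

variable [CharZero k]

/-- An element of the symmetric algebra of a space of linear forms is determined by the polynomial
function it defines. -/
lemma symmetricAlgebra_eq_zero_of_forall {V W : Type*} [AddCommGroup V] [Module k V]
    [AddCommMonoid W] [Module k W] [Module.Free k W] (j : W →ₗ[k] Module.Dual k V)
    (hj : Function.Injective j) (P : SymmetricAlgebra k W)
    (hP : ∀ x, SymmetricAlgebra.lift (LinearMap.applyₗ x ∘ₗ j) P = 0) : P = 0 := by
  let b := Module.Free.chooseBasis k W
  obtain ⟨q, rfl⟩ : ∃ q, (SymmetricAlgebra.equivMvPolynomial b).symm q = P :=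
    (SymmetricAlgebra.equivMvPolynomial b).symm.surjective P
  suffices q = 0 by rw [this, map_zero]
  -- Only finitely many variables occur. The corresponding independent forms take all values in `k ^
  -- σ`, so `q` vanishes at every point there.
  obtain ⟨σ, q, rfl⟩ := MvPolynomial.exists_finset_rename q
  suffices q = 0 by rw [this, map_zero]
  refine MvPolynomial.funext fun c => ?_
  have hli : LinearIndependent k fun i : σ => j (b i) :=
    (b.linearIndependent.map_injOn j hj.injOn).comp _ Subtype.val_injective
  obtain ⟨x, hx⟩ := exists_forall_eq_of_linearIndependent hli c
  have hcomp : ((SymmetricAlgebra.lift (LinearMap.applyₗ x ∘ₗ j)).comp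
      ((SymmetricAlgebra.equivMvPolynomial b).symm : _ →ₐ[k] _)).comp
        (MvPolynomial.rename (Subtype.val : σ → _)) = MvPolynomial.aeval c := by
    refine MvPolynomial.algHom_ext fun i => ?_
    rw [AlgHom.comp_apply, AlgHom.comp_apply, MvPolynomial.rename_X, AlgEquiv.coe_toAlgHom,
      SymmetricAlgebra.equivMvPolynomial_symm_X, SymmetricAlgebra.lift_ι_apply,
      MvPolynomial.aeval_X]
    exact hx i
  rw [map_zero, ← hP x]
  exact (DFunLike.congr_fun hcomp q).symm

variable (φ) in
/-- Restriction of functionals to the formal one-parameter group of `x`, as a morphism of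
algebras. -/
def expSeries (x : L) : φ.Uc →ₐ[k] k⟦X⟧ :=
  AlgHom.ofLinearMap (expSeriesLinear φ x)
    (by
      ext n
      rw [coeff_expSeriesLinear, eval_one, counit_pow, coeff_one]
      split_ifs with h
      · simp [h]
      · simp)
    (fun f g => by
      ext n
      rw [coeff_expSeriesLinear, coeff_mul, eval_mul, comul_pow, map_sum, Finset.mul_sum]
      refine Finset.sum_congr rfl fun m hm => ?_
      rw [map_smul, pair2_tmul, coeff_expSeriesLinear, coeff_expSeriesLinear, smul_eq_mul,
        ← choose_mul_factorials hm]
      have h0 : (n.choose m.1 : k) ≠ 0 := fun h => by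
        have := choose_mul_factorials (k := k) hm
        rw [h, zero_mul, zero_mul] at this
        exact Nat.cast_ne_zero.mpr n.factorial_ne_zero this.symm
      have h1 : (m.1.factorial : k) ≠ 0 := Nat.cast_ne_zero.mpr (Nat.factorial_ne_zero _)
      have h2 : (m.2.factorial : k) ≠ 0 := Nat.cast_ne_zero.mpr (Nat.factorial_ne_zero _)
      field_simp)

lemma coeff_expSeries (x : L) (f : φ.Uc) (n : ℕ) :
    coeff n (expSeries φ x f) = (n.factorial : k)⁻¹ * Uc.eval f (ι k x ^ n) :=
  coeff_expSeriesLinear x f n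

lemma ext_of_eval_pow {f g : φ.Uc}
    (h : ∀ (x : L) (n : ℕ), Uc.eval f (ι k x ^ n) = Uc.eval g (ι k x ^ n)) : f = g := by
  apply Uc.eval_injective
  ext u
  have hle : powerSpan k L ≤ LinearMap.eqLocus (Uc.eval f) (Uc.eval g) := by
    refine Submodule.span_le.mpr ?_
    rintro _ ⟨x, n, rfl⟩
    exact h x n
  exact hle (by rw [powerSpan_eq_top]; trivial)

lemma ext_of_expSeries {f g : φ.Uc} (h : ∀ x : L, expSeries φ x f = expSeries φ x g) : f = g := by
  refine ext_of_eval_pow fun x n => ?_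
  have := congrArg (coeff n) (h x)
  rw [coeff_expSeries, coeff_expSeries] at this
  exact mul_left_cancel₀ (inv_ne_zero (Nat.cast_ne_zero.mpr n.factorial_ne_zero)) this

variable [∀ p, FiniteDimensional k (φ.Quo p)]

/-- On `x ^ n` the transpose of `J ^ m` is multiplication by `n!` times the `n`-th coefficient of
`(exp - 1) ^ m`, and `log (exp t) = t` leaves only `n = 1`. -/
lemma eval_euler_pow (f : φ.Uc) (x : L) (n : ℕ) :
    Uc.eval (φ.euler f) (ι k x ^ n) = if n = 1 then (φ.toK f : Module.Dual k L) x else 0 := by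
  obtain ⟨N, hN⟩ := exists_J_pow_eq_zero f
  -- Cutting at `N` loses no term of the sum defining `euler f`. Cutting at no less than `n` is
  -- required by `coeff_log_exp`.
  have h : φ.euler f = ∑ m ∈ Finset.range (max N n),
      ((-1) ^ m / (m + 1) : k) • (φ.J ^ (m + 1)) f := by
    refine finsum_eq_sum_of_support_subset _ fun m hm => ?_
    rw [Finset.coe_range, Set.mem_Iio]
    by_contra hlt
    exact hm (by
      change ((-1) ^ m / (m + 1) : k) • (φ.J ^ (m + 1)) f = 0
      rw [hN (m + 1) (by omega), smul_zero])
  have hact : ∀ m, (((toConv LinearMap.id - 1 : WithConv (UniversalEnvelopingAlgebra k L →ₗ[k]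
      UniversalEnvelopingAlgebra k L)) ^ m) (ι k x ^ n)) =
      ((n.factorial : k) * coeff n ((exp k - 1) ^ m)) • ι k x ^ n :=
    fun m => ((ActsBy.id.sub ActsBy.one).pow m) x n
  rw [h, map_sum, LinearMap.sum_apply]
  have hterm : ∀ m : ℕ, Uc.eval (((-1) ^ m / (m + 1) : k) • (φ.J ^ (m + 1)) f) (ι k x ^ n) =
      ((-1) ^ m / (m + 1) : k) * coeff n ((exp k - 1) ^ (m + 1)) *
        (n.factorial * Uc.eval f (ι k x ^ n)) := by
    intro m
    rw [map_smul, LinearMap.smul_apply, eval_J_pow, hact, map_smul, smul_eq_mul, smul_eq_mul]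
    ring
  rw [Finset.sum_congr rfl fun m _ => hterm m, ← Finset.sum_mul,
    coeff_log_exp _ _ (le_max_right N n)]
  split_ifs with h1
  · rw [h1, toK_apply, pow_one, Nat.factorial_one, Nat.cast_one, one_mul, one_mul]
  · rw [zero_mul]

lemma toK_euler (f : φ.Uc) : φ.toK (φ.euler f) = φ.toK f := by
  apply Subtype.ext
  ext x
  rw [toK_apply, ← pow_one (ι k x), eval_euler_pow, if_pos rfl]

lemma euler_eq_of_toK_eq {f g : φ.Uc} (h : φ.toK f = φ.toK g) : φ.euler f = φ.euler g :=
  ext_of_eval_pow fun x n => by rw [eval_euler_pow, eval_euler_pow, h]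

/-- Write `s (π f) = e g`. Applying `π` gives `π g = π f`, and `e` depends only on the image under
`π`. -/
lemma euler_eq_of_isEulerEmbedding {s : φ.K →ₗ[k] φ.Uc} (hs : φ.IsEulerEmbedding s) (f : φ.Uc) :
    φ.euler f = s (φ.toK f) := by
  obtain ⟨g, hg⟩ : s (φ.toK f) ∈ LinearMap.range φ.euler := hs.1 ▸ LinearMap.mem_range_self s _
  rw [← hg]
  refine euler_eq_of_toK_eq ?_
  rw [← toK_euler g, hg]
  exact (LinearMap.congr_fun hs.2 (φ.toK f)).symm

/-- Take `s = e ∘ r` for any linear section `r` of `π`; the choice of `r` does not matter because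
`e` factors through `π`. -/
lemma existsUnique_isEulerEmbedding : ∃! s : φ.K →ₗ[k] φ.Uc, φ.IsEulerEmbedding s := by
  obtain ⟨r, hr⟩ := φ.toK.exists_rightInverse_of_surjective
    (LinearMap.range_eq_top.mpr φ.toK_surjective)
  have hr' : ∀ κ, φ.toK (r κ) = κ := LinearMap.congr_fun hr
  refine ⟨φ.euler ∘ₗ r, ⟨le_antisymm (LinearMap.range_comp_le_range r φ.euler) ?_, ?_⟩,
    fun s hs => ?_⟩
  · rintro _ ⟨f, rfl⟩
    exact ⟨φ.toK f, euler_eq_of_toK_eq (hr' _)⟩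
  · refine LinearMap.ext fun κ => ?_
    rw [LinearMap.comp_apply, LinearMap.comp_apply, toK_euler, hr', LinearMap.id_apply]
  · refine LinearMap.ext fun κ => ?_
    rw [LinearMap.comp_apply, euler_eq_of_isEulerEmbedding hs, hr']

lemma expSeries_embedding {s : φ.K →ₗ[k] φ.Uc} (hs : φ.IsEulerEmbedding s) (κ : φ.K) (x : L) :
    expSeries φ x (s κ) = C ((κ : Module.Dual k L) x) * X := by
  obtain ⟨f, rfl⟩ := φ.toK_surjective κ
  rw [← euler_eq_of_isEulerEmbedding hs]
  ext n
  rw [coeff_expSeries, eval_euler_pow, coeff_C_mul, coeff_X]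
  split_ifs with h
  · rw [h, Nat.factorial_one, Nat.cast_one, inv_one, one_mul, mul_one]
  · rw [mul_zero, mul_zero]

/-- The function `x ↦ g(x ^ n)` is a homogeneous polynomial of degree `n` in the coordinates of
`L_p`. Expanding only the first factor of `x ^ (n + 1)` in a basis `b i` splits off a coordinate and
leaves the functionals `u ↦ g(b i * u)` in degree `n`, hence the induction over all `g`. -/
lemma exists_lift_eq_monomial {s : φ.K →ₗ[k] φ.Uc} (hs : φ.IsEulerEmbedding s) (p n : ℕ) :
    ∀ g : UniversalEnvelopingAlgebra k (φ.Quo p) →ₗ[k] k, ∃ P : SymmetricAlgebra k φ.K,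
      ∀ x, expSeries φ x (SymmetricAlgebra.lift s P) =
        C (g (ι k (φ.proj p x) ^ n)) * X ^ n := by
  induction n with
  | zero =>
    intro g
    refine ⟨algebraMap k _ (g 1), fun x => ?_⟩
    rw [AlgHom.commutes, AlgHom.commutes, pow_zero, pow_zero, mul_one]
    rfl
  | succ n ih =>
    intro g
    let b := Module.finBasis k (φ.Quo p)
    choose P hP using fun i => ih (g ∘ₗ LinearMap.mulLeft k (ι k (b i)))
    let κ : Fin _ → φ.K := fun i => ⟨(φ.proj p).toLinearMap.dualMap (b.coord i), p, ⟨_, rfl⟩⟩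
    refine ⟨∑ i, SymmetricAlgebra.ι k φ.K (κ i) * P i, fun x => ?_⟩
    have hx : g (ι k (φ.proj p x) ^ (n + 1)) =
        ∑ i, (κ i : Module.Dual k L) x * g (ι k (b i) * ι k (φ.proj p x) ^ n) := by
      have h1 : ι k (φ.proj p x) = ∑ i, (κ i : Module.Dual k L) x • ι k (b i) := by
        conv_lhs => rw [← b.sum_repr (φ.proj p x), map_sum]
        exact Finset.sum_congr rfl fun i _ => map_smul _ _ _
      rw [pow_succ']
      conv_lhs =>
        enter [2, 1]
        rw [h1]
      rw [Finset.sum_mul, map_sum]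
      exact Finset.sum_congr rfl fun i _ => by rw [smul_mul_assoc, map_smul, smul_eq_mul]
    rw [map_sum, map_sum, hx, map_sum, Finset.sum_mul]
    refine Finset.sum_congr rfl fun i _ => ?_
    rw [map_mul, map_mul, SymmetricAlgebra.lift_ι_apply, expSeries_embedding hs, hP, map_mul,
      pow_succ]
    change _ * _ * (C (g (ι k (b i) * ι k (φ.proj p x) ^ n)) * _) = _
    ring

lemma lift_surjective {s : φ.K →ₗ[k] φ.Uc} (hs : φ.IsEulerEmbedding s) :
    Function.Surjective (SymmetricAlgebra.lift s : SymmetricAlgebra k φ.K →ₐ[k] φ.Uc) := by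
  intro f
  obtain ⟨p, j, hf⟩ := mem_ucSubalgebra.mp f.2
  obtain ⟨g, hg, hfg⟩ := mem_UcStage.mp hf
  have hev : ∀ x n, Uc.eval f (ι k x ^ n) = g (ι k (φ.proj p x) ^ n) := fun x n => by
    change f.1.ofConv _ = _
    rw [hfg, LinearMap.comp_apply, AlgHom.toLinearMap_apply, map_pow, envMap_ι]
  -- The factor `1 / n!` matches the normalisation of `expSeries`.
  choose P hP using fun n => exists_lift_eq_monomial hs p n ((n.factorial : k)⁻¹ • g)
  refine ⟨∑ n ∈ Finset.range (j + 1), P n, ext_of_expSeries fun x => ?_⟩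
  ext m
  rw [map_sum, map_sum, map_sum, coeff_expSeries, hev]
  simp only [hP, coeff_C_mul_X_pow]
  rw [Finset.sum_ite_eq]
  split_ifs with hm
  · rfl
  · rw [Finset.mem_range, not_lt] at hm
    rw [hg, mul_zero]
    -- For `m > j` the power `x ^ m` lies in the `m`-th power of the augmentation ideal, hence in
    -- `F^(j+1)`, where `g` vanishes. So the finite sum over `n ≤ j` captures all of `f`.
    refine (φ.quo p).envFil_antitone hm ((φ.quo p).counit_ker_pow_le m ?_)
    exact Submodule.pow_mem_pow _ (counit_ι _) m

/-- The series of `ψ P` along `x` is `P(t x)`. If it vanishes, then setting `t = 1` gives `P(x) = 0`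
for every `x`, so `P = 0`. -/
lemma lift_injective {s : φ.K →ₗ[k] φ.Uc} (hs : φ.IsEulerEmbedding s) :
    Function.Injective (SymmetricAlgebra.lift s : SymmetricAlgebra k φ.K →ₐ[k] φ.Uc) := by
  rw [injective_iff_map_eq_zero]
  intro P hP
  refine symmetricAlgebra_eq_zero_of_forall φ.K.subtype (Submodule.subtype_injective _) P
    fun x => ?_
  -- `T P` is `P(t x)` as a polynomial in `t`, since a power series could not be evaluated at `t =
  -- 1`.
  let T : SymmetricAlgebra k φ.K →ₐ[k] Polynomial k := SymmetricAlgebra.lift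
    (LinearMap.toSpanSingleton k _ Polynomial.X ∘ₗ LinearMap.applyₗ x ∘ₗ φ.K.subtype)
  have hT : ∀ κ : φ.K, T (SymmetricAlgebra.ι k φ.K κ) =
      (κ : Module.Dual k L) x • Polynomial.X := fun κ => SymmetricAlgebra.lift_ι_apply _ κ
  have hcomp : (expSeries φ x).comp (SymmetricAlgebra.lift s) =
      (Polynomial.coeToPowerSeries.algHom k).comp T := by
    refine SymmetricAlgebra.algHom_ext (LinearMap.ext fun κ => ?_)
    change expSeries φ x (SymmetricAlgebra.lift s (SymmetricAlgebra.ι k φ.K κ)) =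
      Polynomial.coeToPowerSeries.algHom k (T (SymmetricAlgebra.ι k φ.K κ))
    rw [SymmetricAlgebra.lift_ι_apply, hT, expSeries_embedding hs]
    simp [Polynomial.coeToPowerSeries.algHom_apply, Polynomial.smul_eq_C_mul]
  have h0 := DFunLike.congr_fun hcomp P
  rw [AlgHom.comp_apply, hP, map_zero, AlgHom.comp_apply,
    Polynomial.coeToPowerSeries.algHom_apply, Algebra.algebraMap_self, PowerSeries.map_id] at h0
  have h1 : T P = 0 := Polynomial.coe_injective k (h0.symm.trans Polynomial.coe_zero.symm)
  have h2 : (Polynomial.aeval (1 : k)).comp T =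
      SymmetricAlgebra.lift (LinearMap.applyₗ x ∘ₗ φ.K.subtype) := by
    refine SymmetricAlgebra.algHom_ext (LinearMap.ext fun κ => ?_)
    change Polynomial.aeval (1 : k) (T (SymmetricAlgebra.ι k φ.K κ)) =
      SymmetricAlgebra.lift _ (SymmetricAlgebra.ι k φ.K κ)
    rw [hT, SymmetricAlgebra.lift_ι_apply]
    simp
  rw [← h2, AlgHom.comp_apply, h1, map_zero]

end LieFiltration

end PolynomialFunctions

end EulerProof

end FilteredLie

end

theorem mainTheorem7 {k : Type*} [Field k] [CharZero k] {L : Type*} [LieRing L] [LieAlgebra k L]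
    (φ : FilteredLie.LieFiltration k L) [∀ p : ℕ, FiniteDimensional k (φ.Quo p)]
    (hφ : φ.IsComplete) :
    (∃! s : φ.K →ₗ[k] φ.Uc, φ.IsEulerEmbedding s) ∧
      ∀ s : φ.K →ₗ[k] φ.Uc, φ.IsEulerEmbedding s →
        Function.Injective s ∧ (∀ f : φ.Uc, φ.euler f = s (φ.toK f)) ∧
          Function.Bijective (SymmetricAlgebra.lift s : SymmetricAlgebra k φ.K →ₐ[k] φ.Uc) := by
  refine ⟨FilteredLie.LieFiltration.existsUnique_isEulerEmbedding, fun s hs => ⟨?_,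
    FilteredLie.LieFiltration.euler_eq_of_isEulerEmbedding hs,
    FilteredLie.LieFiltration.lift_injective hs, FilteredLie.LieFiltration.lift_surjective hs⟩⟩
  exact Function.LeftInverse.injective (g := φ.toK) (LinearMap.congr_fun hs.2)
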